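/- **Theorem 3.1 (constant magnetic field on the two-torus).** Let $\mathbb T^2=\mathbb R^2/\mathbb Z^2$ carry the flat metric $dx^2+dy^2$. For $N\in\mathbb N$, $N\ge 1$, identify the smooth sections of $L^N$ with the functions $u\in C^\infty(\mathbb R^2,\mathbb C)$ such that $u(x+1,y)=e^{2\pi iNy}u(x,y)$ and $u(x,y+1)=u(x,y)$; the connection on $L^N$ is $d-2\pi iN\,x\,dy$ (for $N=1$ its magnetic field is $F=2\pi\,dx\wedge dy$) and the magnetic Laplacian is $$\Delta^{L^N}=-\frac{\partial^2}{\partial x^2}-\Big(\frac{\partial}{\partial y}-2\pi iN x\Big)^2 .$$ Its eigenvalues, each repeated according to its multiplicity, can be listed as a real sequence $(\nu_{N,j})_{j\ge 0}$. For $E>1$ and $\varphi\in\mathcal S(\mathbb R)$ put $$\lambda_{N,j}=\sqrt{\nu_{N,j}+N^2},\qquad Y_N(\varphi)=\sum_{j=0}^\infty\varphi(\lambda_{N,j}-EN),\qquad \hat\varphi(\xi)=\int_{\mathbb R}\varphi(x)e^{-i\xi x}\,dx .$$ The series $Y_N(\varphi)$ converges absolutely and, for any $E>1$ and any $\varphi\in\mathcal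 S(\mathbb R)$, there is an asymptotic expansion $$Y_N(\varphi)\sim\sum_{j=0}^\infty c_j(N,\varphi)N^{1-j},\qquad N\to\infty,$$ with every $c_j(N,\varphi)$ bounded in $N$; that is, $Y_N(\varphi)-\sum_{j<J}c_j(N,\varphi)N^{1-j}=O(N^{1-J})$ for every $J\ge 0$. The coefficients are explicitly computable: there are polynomials $P_{j,m}$ $(j\ge0,\ 0\le m\le 2j)$ with complex coefficients, depending only on $E$, such that for all $\varphi$, $j$ and $N\ge 1$ $$c_j(N,\varphi)=\sum_{k\in\mathbb Z}\Big(\sum_{m=0}^{2j}P_{j,m}(k)\,\hat\varphi^{(m)}(kE)\Big)e^{ik\pi}e^{-ik\frac{E^2-1}{2}N},$$ and the first two coefficients are $$c_0(N,\varphi)=\frac{E}{2\pi}\sum_{k\in\mathbb Z}\hat\varphi(kE)\,e^{ik\pi}e^{-ik\frac{E^2-1}{2}N},$$ $$c_1(N,\varphi)=\sum_{k\in\mathbb Z}\Big(\frac{i}{2\pi}\hat\varphi'(kE)+\frac{ikE}{4\pi}\hat\varphi''(kE)\Big)e^{ik\pi}e^{-ik\frac{E^2-1}{2}N},$$ all these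 series being absolutely convergent. -/

import Mathlib

open Filter Asymptotics
open scoped SchwartzMap ContDiff Topology

namespace MagneticTorus

/-- Smooth sections of the `N`-th tensor power `L^N` over the two-torus `ℝ²/ℤ²`, where the sections
of `L` are the smooth functions on the plane with `u (x+1, y) = exp (2πiy) u (x, y)` and
`u (x, y+1) = u (x, y)`. -/
def Section (N : ℕ) : Submodule ℂ (ℝ × ℝ → ℂ) where
  carrier := {u | ContDiff ℝ ∞ u ∧
    (∀ x y : ℝ, u (x + 1, y) = Complex.exp (2 * Real.pi * Complex.I * N * y) * u (x, y)) ∧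
    (∀ x y : ℝ, u (x, y + 1) = u (x, y))}
  add_mem' := by
    rintro u v ⟨hu, hu1, hu2⟩ ⟨hv, hv1, hv2⟩
    refine ⟨hu.add hv, fun x y => ?_, fun x y => ?_⟩
    · simp only [Pi.add_apply, hu1, hv1, mul_add]
    · simp only [Pi.add_apply, hu2, hv2]
  zero_mem' := ⟨contDiff_const, fun x y => by simp, fun x y => by simp⟩
  smul_mem' := by
    rintro a u ⟨hu, hu1, hu2⟩
    refine ⟨contDiff_const.smul hu, fun x y => ?_, fun x y => ?_⟩
    · simp only [Pi.smul_apply, hu1, smul_eq_mul]; ring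
    · simp only [Pi.smul_apply, hu2]

theorem Section.differentiable {N : ℕ} (u : Section N) :
    Differentiable ℝ (u : ℝ × ℝ → ℂ) :=
  u.2.1.differentiable (by simp)

theorem fderiv_shift (u : ℝ × ℝ → ℂ) (a p : ℝ × ℝ) :
    fderiv ℝ (fun q => u (q + a)) p = fderiv ℝ u (p + a) :=
  fderiv_comp_add_right a

theorem contDiff_fderiv_apply {u : ℝ × ℝ → ℂ} (hu : ContDiff ℝ ∞ u) (v : ℝ × ℝ) :
    ContDiff ℝ ∞ (fun p => fderiv ℝ u p v) :=
  (hu.fderiv_right (m := ∞) (by simp)).clm_apply contDiff_const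

/-- The derivative of a section at the point shifted by `(0, 1)`. -/
theorem fderiv_shift_y {N : ℕ} (u : Section N) (x y : ℝ) :
    fderiv ℝ (u : ℝ × ℝ → ℂ) (x, y + 1) = fderiv ℝ (u : ℝ × ℝ → ℂ) (x, y) := by
  have h := fderiv_shift (u : ℝ × ℝ → ℂ) (0, 1) (x, y)
  have h2 : (fun q : ℝ × ℝ => (u : ℝ × ℝ → ℂ) (q + (0, 1))) = u := by
    funext q
    obtain ⟨a, b⟩ := q
    simpa using u.2.2.2 a b
  rw [h2] at h
  simpa using h.symm

/-- The derivative of a section at the point shifted by `(1, 0)`. -/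
theorem fderiv_shift_x {N : ℕ} (u : Section N) (x y : ℝ) (v : ℝ × ℝ) :
    fderiv ℝ (u : ℝ × ℝ → ℂ) (x + 1, y) v =
      Complex.exp (2 * Real.pi * Complex.I * N * y) *
        (fderiv ℝ (u : ℝ × ℝ → ℂ) (x, y) v +
          2 * Real.pi * Complex.I * N * v.2 * (u : ℝ × ℝ → ℂ) (x, y)) := by
  have h := fderiv_shift (u : ℝ × ℝ → ℂ) (1, 0) (x, y)
  have h2 : (fun q : ℝ × ℝ => (u : ℝ × ℝ → ℂ) (q + (1, 0))) =
      fun q : ℝ × ℝ => Complex.exp (2 * Real.pi * Complex.I * N * (q.2 : ℝ)) *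
        (u : ℝ × ℝ → ℂ) q := by
    funext q
    obtain ⟨a, b⟩ := q
    simpa using u.2.2.1 a b
  have h3 : HasFDerivAt (fun q : ℝ × ℝ => (2 * Real.pi * Complex.I * N * (q.2 : ℝ) : ℂ))
      ((2 * Real.pi * Complex.I * N : ℂ) •
        (Complex.ofRealCLM.comp (ContinuousLinearMap.snd ℝ ℝ ℝ))) (x, y) :=
    (Complex.ofRealCLM.comp (ContinuousLinearMap.snd ℝ ℝ ℝ)).hasFDerivAt.const_mul _
  have h4 := (h3.cexp).mul (Section.differentiable u (x, y)).hasFDerivAt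
  rw [h2] at h
  have h5 := h4.fderiv.symm.trans h
  have h6 := congrArg (fun T : ℝ × ℝ →L[ℝ] ℂ => T v) h5
  simp at h6
  rw [← h6]
  ring

/-- The covariant derivative `∇_x = ∂/∂x` on `L^N` (the connection is `d - 2πiN x dy`). -/
noncomputable def covX (N : ℕ) : Section N →ₗ[ℂ] Section N where
  toFun u := ⟨fun p => fderiv ℝ (u : ℝ × ℝ → ℂ) p (1, 0), by
    refine ⟨contDiff_fderiv_apply u.2.1 _, fun x y => ?_, fun x y => ?_⟩
    · simp [fderiv_shift_x]
    · simp [fderiv_shift_y]⟩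
  map_add' u v := by
    ext p
    simp [fderiv_add (Section.differentiable u p) (Section.differentiable v p)]
  map_smul' a u := by
    ext p
    simp [fderiv_const_smul (Section.differentiable u p)]

/-- The covariant derivative `∇_y = ∂/∂y - 2πiN x` on `L^N`. -/
noncomputable def covY (N : ℕ) : Section N →ₗ[ℂ] Section N where
  toFun u := ⟨fun p => fderiv ℝ (u : ℝ × ℝ → ℂ) p (0, 1) -
      2 * Real.pi * Complex.I * N * (p.1 : ℝ) * (u : ℝ × ℝ → ℂ) p, by
    refine ⟨?_, fun x y => ?_, fun x y => ?_⟩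
    · refine (contDiff_fderiv_apply u.2.1 _).sub (ContDiff.mul ?_ u.2.1)
      exact contDiff_const.mul (Complex.ofRealCLM.contDiff.comp contDiff_fst)
    · simp only [fderiv_shift_x, u.2.2.1 x y]
      push_cast
      ring
    · simp only [fderiv_shift_y, u.2.2.2 x y]⟩
  map_add' u v := by
    ext p
    simp [fderiv_add (Section.differentiable u p) (Section.differentiable v p)]
    ring
  map_smul' a u := by
    ext p
    simp [fderiv_const_smul (Section.differentiable u p)]
    ring

/-- The magnetic (Bochner) Laplacian `-∂²/∂x² - (∂/∂y - 2πiN x)²` on smooth sections of `L^N`,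
for the flat metric `dx² + dy²`. -/
noncomputable def magneticLaplacian (N : ℕ) : Module.End ℂ (Section N) :=
  -(covX N ∘ₗ covX N + covY N ∘ₗ covY N)

/-- `ν 0, ν 1, …` is the list of all eigenvalues of the magnetic Laplacian on `L^N`, each repeated
according to its multiplicity: every complex number `μ` occurs in the list exactly
`dim ker (Δ - μ)` times. -/
def IsEigenvalueList (N : ℕ) (ν : ℕ → ℝ) : Prop :=
  ∀ μ : ℂ, Cardinal.mk {j : ℕ // (ν j : ℂ) = μ} =
    Module.rank ℂ (Module.End.eigenspace (magneticLaplacian N) μ)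

/-- The summand `φ (λ_j - E N)`, with `λ_j = √(ν_j + N²)`. -/
noncomputable def summand (φ : 𝓢(ℝ, ℂ)) (E : ℝ) (N : ℕ) (ν : ℕ → ℝ) (j : ℕ) : ℂ :=
  φ (Real.sqrt (ν j + (N : ℝ) ^ 2) - E * N)

/-- The sum `Y_N(φ) = ∑_j φ (λ_j - E N)`. -/
noncomputable def Y (φ : 𝓢(ℝ, ℂ)) (E : ℝ) (N : ℕ) (ν : ℕ → ℝ) : ℂ :=
  ∑' j : ℕ, summand φ E N ν j

/-- The Fourier transform `∫ φ(x) exp(-iξx) dx`, without `2π` in the exponent. -/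
noncomputable def hat (φ : 𝓢(ℝ, ℂ)) (ξ : ℝ) : ℂ :=
  ∫ x : ℝ, φ x * Complex.exp (-(Complex.I * ξ * x))

/-- The oscillating factor `exp(ikπ) exp(-ik (E² - 1) N / 2)`. -/
noncomputable def phase (E : ℝ) (N : ℕ) (k : ℤ) : ℂ :=
  Complex.exp (Complex.I * k * Real.pi) *
    Complex.exp (-(Complex.I * k * (((E ^ 2 - 1) / 2 : ℝ) : ℂ) * N))

end MagneticTorus

/-! The spectrum is exactly solvable. Since `[∇_x, ∇_y] = -2πiN`, the operators `∇_x ± i∇_y` shift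
eigenvalues of the Laplacian by `4πN`, isomorphically except at the bottom. A maximum principle
excludes eigenvalues with negative real part, so only the Landau levels `2πN(2n+1)` occur, all with
the multiplicity of the lowest one. That one consists of the solutions of a first-order equation:
their Fourier coefficients in `y` are Gaussians determined by `N` constants, and `N` theta functions
realise them. Hence every multiplicity is `N` (`rank_eigenspace_field`, `rank_eigenspace_level`),
and `Y_N` is `N` times a sum over the levels.

For the asymptotics, put `x = λ_n - EN` and `σ = x + x²/(2EN) = (λ_n² - E²N²)/(2EN)`. As `λ_n²` is
affine in `n`, the points `σ` form an arithmetic progression of step `2π/E`. Solving back, `x` is a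
function of `σ` and `h = 1/N` equal to `σ` at `h = 0`. Taylor's formula in `h` replaces `φ(x)` by
Schwartz functions of `σ`, with remainder `O(h^J (1+σ²)⁻¹)`, summable uniformly in `N`
(`exists_bound_remainder`). The missing indices `n < 0` cost `O(N^(-∞))`, because `E > 1` puts their
nodes below `-κN` with `κ > 0`. Poisson summation over all integers (`hasSum_phase`) then gives the
oscillating series. -/

namespace MagneticTorus

/-! ### The Fourier transform `hat` -/

/-- Multiplication of a Schwartz function by the coordinate. -/
noncomputable def mulX (ψ : 𝓢(ℝ, ℂ)) : 𝓢(ℝ, ℂ) :=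
  SchwartzMap.smulLeftCLM ℂ Complex.ofRealCLM ψ

@[simp] theorem mulX_apply (ψ : 𝓢(ℝ, ℂ)) (x : ℝ) : mulX ψ x = x * ψ x := by
  rw [mulX, SchwartzMap.smulLeftCLM_apply_apply Complex.ofRealCLM.hasTemperateGrowth]
  rfl

/-- The operator `ψ ↦ x² ψ'`. -/
noncomputable def sqDeriv (ψ : 𝓢(ℝ, ℂ)) : 𝓢(ℝ, ℂ) :=
  mulX (mulX (SchwartzMap.derivCLM ℂ ℂ ψ))

@[simp] theorem sqDeriv_apply (ψ : 𝓢(ℝ, ℂ)) (x : ℝ) : sqDeriv ψ x = x ^ 2 * deriv ψ x := by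
  simp [sqDeriv]; ring

theorem hat_eq_fourier (ψ : 𝓢(ℝ, ℂ)) (ξ : ℝ) :
    hat ψ ξ = (FourierTransform.fourier ψ : 𝓢(ℝ, ℂ)) (ξ / (2 * Real.pi)) := by
  rw [SchwartzMap.fourier_coe, Real.fourier_real_eq_integral_exp_smul, hat]
  congr 1 with x
  rw [smul_eq_mul, mul_comm]
  congr 2
  push_cast
  have : (Real.pi : ℂ) ≠ 0 := by exact_mod_cast Real.pi_ne_zero
  field_simp

theorem contDiff_hat (ψ : 𝓢(ℝ, ℂ)) : ContDiff ℝ ∞ (hat ψ) := by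
  have : hat ψ = (FourierTransform.fourier ψ : 𝓢(ℝ, ℂ)) ∘ fun ξ : ℝ => ξ / (2 * Real.pi) :=
    funext (hat_eq_fourier ψ)
  rw [this]
  exact ((FourierTransform.fourier ψ : 𝓢(ℝ, ℂ)).smooth ⊤).comp (contDiff_id.div_const _)

theorem hat_add (ψ χ : 𝓢(ℝ, ℂ)) (ξ : ℝ) : hat (ψ + χ) ξ = hat ψ ξ + hat χ ξ := by
  simp [hat_eq_fourier, FourierTransform.fourier_add]

theorem hat_smul (a : ℂ) (ψ : 𝓢(ℝ, ℂ)) (ξ : ℝ) : hat (a • ψ) ξ = a * hat ψ ξ := by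
  simp [hat_eq_fourier, FourierTransform.fourier_smul]

theorem hat_neg (ψ : 𝓢(ℝ, ℂ)) (ξ : ℝ) : hat (-ψ) ξ = -hat ψ ξ := by
  rw [← neg_one_smul ℂ ψ, hat_smul]; ring

theorem hat_mulX (ψ : 𝓢(ℝ, ℂ)) (ξ : ℝ) : hat (mulX ψ) ξ = Complex.I * deriv (hat ψ) ξ := by
  have h := Real.hasDerivAt_fourier ψ.integrable
    (by
      convert! (mulX ψ).integrable (μ := MeasureTheory.volume) using 1
      funext x
      simp)
    (ξ / (2 * Real.pi))
  have h2 := h.scomp ξ ((hasDerivAt_id ξ).div_const (2 * Real.pi))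
  have h3 : hat ψ = FourierTransform.fourier (ψ : ℝ → ℂ) ∘ fun x => id x / (2 * Real.pi) := by
    funext ξ
    simp [hat_eq_fourier, SchwartzMap.fourier_coe]
  rw [h3, h2.deriv, hat_eq_fourier, SchwartzMap.fourier_coe,
    Real.fourier_real_eq_integral_exp_smul, Real.fourier_real_eq_integral_exp_smul,
    ← MeasureTheory.integral_smul, ← MeasureTheory.integral_const_mul]
  congr 1 with x
  have : (Real.pi : ℂ) ≠ 0 := by exact_mod_cast Real.pi_ne_zero
  simp only [mulX_apply, smul_eq_mul, Complex.real_smul]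
  push_cast
  field_simp
  rw [Complex.I_sq]; ring

theorem hat_deriv (ψ : 𝓢(ℝ, ℂ)) (ξ : ℝ) :
    hat (SchwartzMap.derivCLM ℂ ℂ ψ) ξ = Complex.I * ξ * hat ψ ξ := by
  have h := congrFun (Real.fourier_deriv ψ.integrable ψ.differentiable
    (SchwartzMap.derivCLM ℂ ℂ ψ).integrable) (ξ / (2 * Real.pi))
  rw [hat_eq_fourier, hat_eq_fourier, SchwartzMap.fourier_coe, SchwartzMap.fourier_coe]
  have h2 : (SchwartzMap.derivCLM ℂ ℂ ψ : ℝ → ℂ) = deriv ψ := by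
    funext x; simp
  rw [h2, h]
  have : (Real.pi : ℂ) ≠ 0 := by exact_mod_cast Real.pi_ne_zero
  push_cast
  rw [smul_eq_mul]
  field_simp

theorem hasDerivAt_iteratedDeriv {u : ℝ → ℂ} (hu : ContDiff ℝ ∞ u) (m : ℕ) (ξ : ℝ) :
    HasDerivAt (iteratedDeriv m u) (iteratedDeriv (m + 1) u ξ) ξ := by
  rw [iteratedDeriv_succ]
  exact ((hu.differentiable_iteratedDeriv m
    (by exact_mod_cast WithTop.coe_lt_top m)) ξ).hasDerivAt

/-- Multiplication by `x` becomes `i d/dξ` and `d/dx` becomes `iξ`, so the result is `-(iξ f)''`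
with `f = hat ψ`. -/
theorem hat_sqDeriv (ψ : 𝓢(ℝ, ℂ)) (ξ : ℝ) :
    hat (sqDeriv ψ) ξ = -Complex.I *
      (ξ * iteratedDeriv 2 (hat ψ) ξ + 2 * iteratedDeriv 1 (hat ψ) ξ) := by
  have h0 := fun ξ => hasDerivAt_iteratedDeriv (contDiff_hat ψ) 0 ξ
  have h1 := fun ξ => hasDerivAt_iteratedDeriv (contDiff_hat ψ) 1 ξ
  simp only [iteratedDeriv_zero, zero_add, Nat.reduceAdd] at h0 h1
  have e1 : deriv (hat (SchwartzMap.derivCLM ℂ ℂ ψ)) = fun ξ : ℝ =>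
      Complex.I * hat ψ ξ + Complex.I * ξ * iteratedDeriv 1 (hat ψ) ξ := by
    funext ξ
    rw [show hat (SchwartzMap.derivCLM ℂ ℂ ψ) = fun ξ : ℝ => Complex.I * ξ * hat ψ ξ from
      funext (hat_deriv ψ)]
    have := ((Complex.ofRealCLM.hasDerivAt (x := ξ)).const_mul Complex.I).mul (h0 ξ)
    simpa [Pi.mul_def] using this.deriv
  have e2 : hat (mulX (SchwartzMap.derivCLM ℂ ℂ ψ)) = fun ξ : ℝ =>
      Complex.I * (Complex.I * hat ψ ξ + Complex.I * ξ * iteratedDeriv 1 (hat ψ) ξ) := by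
    funext ξ; rw [hat_mulX, e1]
  rw [sqDeriv, hat_mulX, e2]
  have := (((h0 ξ).const_mul Complex.I).add
    (((Complex.ofRealCLM.hasDerivAt (x := ξ)).const_mul Complex.I).mul (h1 ξ))).const_mul Complex.I
  replace this := this.deriv
  simp only [Pi.add_def, Pi.mul_def, Complex.ofRealCLM_apply] at this
  rw [this]
  push_cast
  linear_combination (norm := ring_nf) (iteratedDeriv 2 (hat ψ) ξ * ξ * Complex.I +
    2 * iteratedDeriv 1 (hat ψ) ξ * Complex.I) * Complex.I_sq

theorem iteratedDeriv_hat_mulX (ψ : 𝓢(ℝ, ℂ)) (m : ℕ) (ξ : ℝ) :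
    iteratedDeriv m (hat (mulX ψ)) ξ = Complex.I * iteratedDeriv (m + 1) (hat ψ) ξ := by
  induction m generalizing ξ with
  | zero => simp [hat_mulX]
  | succ m ih =>
    rw [iteratedDeriv_succ, funext ih]
    exact ((hasDerivAt_iteratedDeriv (contDiff_hat ψ) (m + 1) ξ).const_mul _).deriv

theorem iteratedDeriv_hat_sqDeriv (ψ : 𝓢(ℝ, ℂ)) (m : ℕ) (ξ : ℝ) :
    iteratedDeriv m (hat (sqDeriv ψ)) ξ = -Complex.I *
      (ξ * iteratedDeriv (m + 2) (hat ψ) ξ + (m + 2) * iteratedDeriv (m + 1) (hat ψ) ξ) := by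
  induction m generalizing ξ with
  | zero => simp [hat_sqDeriv]
  | succ m ih =>
    rw [iteratedDeriv_succ, funext ih]
    have h1 := hasDerivAt_iteratedDeriv (contDiff_hat ψ) (m + 1) ξ
    have h2 := hasDerivAt_iteratedDeriv (contDiff_hat ψ) (m + 2) ξ
    have := ((((Complex.ofRealCLM.hasDerivAt (x := ξ)).mul h2).add
      (h1.const_mul ((m : ℂ) + 2))).const_mul (-Complex.I)).deriv
    simp only [Complex.ofRealCLM_apply] at this
    refine this.trans ?_
    simp; ring

/-- A functional of a Schwartz function and a frequency of the form
`∑_{m ≤ d} P_m(ξ) (hat ψ)^{(m)}(ξ)`. -/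
def IsFourierForm (d : ℕ) (F : 𝓢(ℝ, ℂ) → ℝ → ℂ) : Prop :=
  ∃ P : ℕ → Polynomial ℂ, ∀ ψ ξ, F ψ ξ =
    ∑ m ∈ Finset.range (d + 1), (P m).eval (ξ : ℂ) * iteratedDeriv m (hat ψ) ξ

theorem isFourierForm_iteratedDeriv {d m : ℕ} (h : m ≤ d) :
    IsFourierForm d fun ψ ξ => iteratedDeriv m (hat ψ) ξ := by
  refine ⟨fun i => if i = m then 1 else 0, fun ψ ξ => ?_⟩
  rw [Finset.sum_eq_single_of_mem m (by simp; omega)]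
  · simp
  · intro b _ hb; simp [hb]

theorem IsFourierForm.add {d : ℕ} {F G : 𝓢(ℝ, ℂ) → ℝ → ℂ} (hF : IsFourierForm d F)
    (hG : IsFourierForm d G) : IsFourierForm d fun ψ ξ => F ψ ξ + G ψ ξ := by
  obtain ⟨P, hP⟩ := hF
  obtain ⟨Q, hQ⟩ := hG
  refine ⟨fun m => P m + Q m, fun ψ ξ => ?_⟩
  simp only [hP, hQ, Polynomial.eval_add, add_mul, Finset.sum_add_distrib]

theorem IsFourierForm.polynomial_mul {d : ℕ} {F : 𝓢(ℝ, ℂ) → ℝ → ℂ} (hF : IsFourierForm d F)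
    (p : Polynomial ℂ) : IsFourierForm d fun ψ ξ => p.eval (ξ : ℂ) * F ψ ξ := by
  obtain ⟨P, hP⟩ := hF
  refine ⟨fun m => p * P m, fun ψ ξ => ?_⟩
  simp only [hP, Polynomial.eval_mul, Finset.mul_sum, mul_assoc]

theorem IsFourierForm.const_mul {d : ℕ} {F : 𝓢(ℝ, ℂ) → ℝ → ℂ} (hF : IsFourierForm d F)
    (a : ℂ) : IsFourierForm d fun ψ ξ => a * F ψ ξ := by
  simpa using hF.polynomial_mul (Polynomial.C a)

theorem IsFourierForm.sum {d : ℕ} {ι : Type*} (s : Finset ι) {F : ι → 𝓢(ℝ, ℂ) → ℝ → ℂ}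
    (hF : ∀ i ∈ s, IsFourierForm d (F i)) : IsFourierForm d fun ψ ξ => ∑ i ∈ s, F i ψ ξ := by
  classical
  induction s using Finset.induction_on with
  | empty => exact ⟨0, by simp⟩
  | insert i s hi ih =>
    simp only [Finset.sum_insert hi]
    exact (hF i (by simp)).add (ih fun j hj => hF j (by simp [hj]))

/-- Only one more derivative is needed; the bound `d + 2` is chosen to match
`IsFourierForm.comp_sqDeriv`. -/
theorem IsFourierForm.comp_mulX {d : ℕ} {F : 𝓢(ℝ, ℂ) → ℝ → ℂ} (hF : IsFourierForm d F) :
    IsFourierForm (d + 2) fun ψ ξ => F (mulX ψ) ξ := by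
  obtain ⟨P, hP⟩ := hF
  simp only [hP, iteratedDeriv_hat_mulX]
  refine IsFourierForm.sum _ fun m hm => ?_
  have := Finset.mem_range.1 hm
  exact ((isFourierForm_iteratedDeriv (by omega)).const_mul _).polynomial_mul _

theorem IsFourierForm.comp_sqDeriv {d : ℕ} {F : 𝓢(ℝ, ℂ) → ℝ → ℂ} (hF : IsFourierForm d F) :
    IsFourierForm (d + 2) fun ψ ξ => F (sqDeriv ψ) ξ := by
  obtain ⟨P, hP⟩ := hF
  simp only [hP, iteratedDeriv_hat_sqDeriv]
  refine IsFourierForm.sum _ fun m hm => ?_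
  have := Finset.mem_range.1 hm
  refine (IsFourierForm.const_mul (IsFourierForm.add ?_ ?_) _).polynomial_mul _
  · simpa using (isFourierForm_iteratedDeriv (d := d + 2) (m := m + 2)
      (by omega)).polynomial_mul Polynomial.X
  · exact (isFourierForm_iteratedDeriv (by omega)).const_mul _

/-! ### The `h`-derivatives of `ψ ∘ X` -/

/-- The solution `x` of `σ = x + a h x²` which is close to `σ` for small `h`. -/
noncomputable def inv (a h σ : ℝ) : ℝ := 2 * σ / (1 + √(1 + 4 * a * h * σ))

/-- The `σ`-derivative of `inv`. -/
noncomputable def invDeriv (a h σ : ℝ) : ℝ := (√(1 + 4 * a * h * σ))⁻¹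

/-- The Schwartz function which is the value at `h = 0` of the `j`-th `h`-derivative of
`invDeriv ^ m * ψ ∘ inv`. -/
noncomputable def expansionOp (a : ℝ) : ℕ → ℕ → 𝓢(ℝ, ℂ) → 𝓢(ℝ, ℂ)
  | 0, _, ψ => ψ
  | j + 1, m, ψ => -((a : ℂ) • (expansionOp a j (m + 1) (sqDeriv ψ) + (m : ℂ) •
      (expansionOp a j (m + 2) (mulX ψ) + expansionOp a j (m + 1) (mulX ψ))))

/-- The `j`-th `h`-derivative of `invDeriv ^ m * ψ ∘ inv`. -/
noncomputable def paramDeriv (a : ℝ) : ℕ → ℕ → 𝓢(ℝ, ℂ) → ℝ → ℝ → ℂ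
  | 0, m, ψ, h, σ => (invDeriv a h σ : ℂ) ^ m * ψ (inv a h σ)
  | j + 1, m, ψ, h, σ => -((a : ℂ) * (paramDeriv a j (m + 1) (sqDeriv ψ) h σ + (m : ℂ) *
      (paramDeriv a j (m + 2) (mulX ψ) h σ + paramDeriv a j (m + 1) (mulX ψ) h σ)))

theorem paramDeriv_zero_left (a : ℝ) (j m : ℕ) (ψ : 𝓢(ℝ, ℂ)) (σ : ℝ) :
    paramDeriv a j m ψ 0 σ = expansionOp a j m ψ σ := by
  induction j generalizing m ψ with
  | zero => norm_num [paramDeriv, expansionOp, inv, invDeriv]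
  | succ j ih => simp [paramDeriv, expansionOp, ih, mul_add, add_comm, add_left_comm]

/-- Each step of the recursion costs at most two derivatives of the Fourier transform; this is the
source of the range `m ≤ 2j`. -/
theorem isFourierForm_expansionOp (a : ℝ) (j m : ℕ) :
    IsFourierForm (2 * j) fun ψ ξ => hat (expansionOp a j m ψ) ξ := by
  induction j generalizing m with
  | zero => simpa [expansionOp] using isFourierForm_iteratedDeriv (d := 0) (m := 0) le_rfl
  | succ j ih =>
    rw [mul_add, mul_one]
    simp only [expansionOp, hat_neg, hat_smul, hat_add]
    have := ((ih (m + 1)).comp_sqDeriv.add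
      (((ih (m + 2)).comp_mulX.add (ih (m + 1)).comp_mulX).const_mul m)).const_mul (-(a : ℂ))
    simpa only [neg_mul] using this

/-- Implicit differentiation of `x + a h x² = σ`, where `1 + 2 a h x = √(1 + 4 a h σ)` is the
reciprocal of `invDeriv`. -/
theorem hasDerivAt_inv {a h σ : ℝ} (hp : 0 < 1 + 4 * a * h * σ) :
    HasDerivAt (fun h => inv a h σ) (-(a * inv a h σ ^ 2 * invDeriv a h σ)) h := by
  have h1 : HasDerivAt (fun h => 1 + 4 * a * h * σ) (4 * a * σ) h := by
    have := (((hasDerivAt_id h).const_mul (4 * a)).mul_const σ).const_add 1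
    simpa using this
  have hs := Real.sqrt_pos.2 hp
  have h2 := ((h1.sqrt hp.ne').const_add 1)
  have h3 := (hasDerivAt_const h (2 * σ)).div h2 (by positivity)
  convert! h3 using 1
  rw [inv, invDeriv]
  field_simp
  ring

theorem hasDerivAt_invDeriv {a h σ : ℝ} (hp : 0 < 1 + 4 * a * h * σ) :
    HasDerivAt (fun h => invDeriv a h σ)
      (-(a * inv a h σ * (invDeriv a h σ ^ 3 + invDeriv a h σ ^ 2))) h := by
  have h1 : HasDerivAt (fun h => 1 + 4 * a * h * σ) (4 * a * σ) h := by
    have := (((hasDerivAt_id h).const_mul (4 * a)).mul_const σ).const_add 1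
    simpa using this
  have hs := Real.sqrt_pos.2 hp
  have h3 := (h1.sqrt hp.ne').fun_inv (by positivity)
  convert! h3 using 1
  rw [inv, invDeriv]
  field_simp
  ring

/-- With `w = invDeriv` and `x = inv`, one has `∂x/∂h = -a x² w` and `∂w/∂h = -a x (w³ + w²)`. So
the span of the functions `w^m ψ(x)`, with `ψ` Schwartz, is closed under `∂/∂h`. -/
theorem hasDerivAt_paramDeriv (a : ℝ) (j m : ℕ) (ψ : 𝓢(ℝ, ℂ)) {h σ : ℝ}
    (hp : 0 < 1 + 4 * a * h * σ) :
    HasDerivAt (fun h => paramDeriv a j m ψ h σ) (paramDeriv a (j + 1) m ψ h σ) h := by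
  induction j generalizing m ψ with
  | zero =>
    have h1 := (hasDerivAt_invDeriv hp).ofReal_comp.pow m
    have h2 := (ψ.hasDerivAt (inv a h σ)).scomp h (hasDerivAt_inv hp)
    convert! h1.mul h2 using 1
    simp only [paramDeriv, sqDeriv_apply, mulX_apply, Pi.pow_apply, Function.comp]
    rcases m with _ | m
    · simp; ring
    · simp; ring
  | succ j ih =>
    simp only [paramDeriv]
    exact (((ih (m + 1) (sqDeriv ψ)).add (((ih (m + 2) (mulX ψ)).add
      (ih (m + 1) (mulX ψ))).const_mul (m : ℂ))).const_mul (a : ℂ)).neg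

theorem inv_eq {a h σ : ℝ} (hp : 0 ≤ 1 + 4 * a * h * σ) :
    inv a h σ + a * h * inv a h σ ^ 2 = σ := by
  have hs := Real.sqrt_nonneg (1 + 4 * a * h * σ)
  have h2 := Real.sq_sqrt hp
  rw [inv]
  set q := √(1 + 4 * a * h * σ)
  field_simp
  linear_combination (-1 : ℝ) * σ * h2

theorem exists_bound_schwartz (ψ : 𝓢(ℝ, ℂ)) (k : ℕ) :
    ∃ C : ℝ, 0 ≤ C ∧ ∀ x : ℝ, (1 + |x|) ^ k * ‖ψ x‖ ≤ C := by
  refine ⟨_, (by positivity : (0 : ℝ) ≤ 2 ^ k *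
    ((Finset.Iic (k, 0)).sup fun m => SchwartzMap.seminorm ℂ m.1 m.2) ψ), fun x => ?_⟩
  simpa using SchwartzMap.one_add_le_sup_seminorm_apply (𝕜 := ℂ) (m := (k, 0)) le_rfl le_rfl ψ x

/-- For `h ≤ 1`, `σ` grows at most quadratically in `x`, so Schwartz decay in `x` gives decay in `σ`
uniformly in `h`. The bound by `r` keeps `σ` away from the branch point, where `invDeriv` blows up.
-/
theorem exists_bound_paramDeriv {a r : ℝ} (ha : 0 ≤ a) (hr : 0 < r) (j m : ℕ) (ψ : 𝓢(ℝ, ℂ)) :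
    ∃ C : ℝ, 0 ≤ C ∧ ∀ h σ : ℝ, 0 ≤ h → h ≤ 1 → r ^ 2 ≤ 1 + 4 * a * h * σ →
      ‖paramDeriv a j m ψ h σ‖ ≤ C * (1 + σ ^ 2)⁻¹ := by
  induction j generalizing m ψ with
  | zero =>
    obtain ⟨C, hC0, hC⟩ := exists_bound_schwartz ψ 4
    refine ⟨r⁻¹ ^ m * ((1 + a ^ 2) * 2 * C), by positivity, fun h σ h0 h1 hp => ?_⟩
    have hp0 : 0 < 1 + 4 * a * h * σ := lt_of_lt_of_le (by positivity) hp
    have hw : invDeriv a h σ ≤ r⁻¹ :=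
      inv_anti₀ hr (Real.le_sqrt_of_sq_le hp)
    have hw0 : 0 ≤ invDeriv a h σ := by unfold invDeriv; positivity
    set x := inv a h σ with hx
    have hσ : x + a * h * x ^ 2 = σ := inv_eq hp0.le
    have key : 1 + σ ^ 2 ≤ (1 + a ^ 2) * 2 * (1 + |x|) ^ 4 := by
      have hx2 : x ^ 2 = |x| ^ 2 := (sq_abs x).symm
      have hy := abs_nonneg x
      set y := |x|
      have : σ ^ 2 ≤ 2 * (x ^ 2 + (a * h * x ^ 2) ^ 2) := by
        rw [← hσ]; nlinarith [sq_nonneg (x - a * h * x ^ 2)]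
      have h2 : (a * h * x ^ 2) ^ 2 ≤ a ^ 2 * (y ^ 2) ^ 2 := by
        rw [hx2, mul_pow, mul_pow]
        have : h ^ 2 ≤ 1 := pow_le_one₀ h0 h1
        nlinarith [mul_nonneg (sq_nonneg a) (sq_nonneg (y ^ 2)), this]
      have h3 : 1 + 2 * y ^ 2 + 2 * (y ^ 2) ^ 2 ≤ 2 * (1 + y) ^ 4 := by
        ring_nf
        nlinarith [pow_nonneg hy 3, pow_nonneg hy 2]
      have h4 : y ^ 4 ≤ (1 + y) ^ 4 := by gcongr; linarith
      rw [hx2] at this h2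
      nlinarith [mul_le_mul_of_nonneg_left h4 (sq_nonneg a)]
    rw [← div_eq_mul_inv, le_div_iff₀ (by positivity)]
    simp only [paramDeriv, norm_mul, norm_pow, Complex.norm_real, Real.norm_eq_abs,
      abs_of_nonneg hw0]
    calc invDeriv a h σ ^ m * ‖ψ x‖ * (1 + σ ^ 2)
        ≤ r⁻¹ ^ m * ‖ψ x‖ * ((1 + a ^ 2) * 2 * (1 + |x|) ^ 4) := by gcongr
      _ = r⁻¹ ^ m * ((1 + a ^ 2) * 2 * ((1 + |x|) ^ 4 * ‖ψ x‖)) := by ring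
      _ ≤ _ := by gcongr; exact hC x
  | succ j ih =>
    obtain ⟨C1, h01, hC1⟩ := ih (m + 1) (sqDeriv ψ)
    obtain ⟨C2, h02, hC2⟩ := ih (m + 2) (mulX ψ)
    obtain ⟨C3, h03, hC3⟩ := ih (m + 1) (mulX ψ)
    refine ⟨a * (C1 + m * (C2 + C3)), by positivity, fun h σ h0 h1 hp => ?_⟩
    simp only [paramDeriv, norm_neg, norm_mul, Complex.norm_real, Real.norm_eq_abs,
      abs_of_nonneg ha]
    rw [mul_assoc]
    gcongr
    refine (norm_add_le _ _).trans ?_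
    rw [norm_mul, Complex.norm_natCast, add_mul, mul_assoc]
    gcongr
    · exact hC1 h σ h0 h1 hp
    · refine (norm_add_le _ _).trans ?_
      rw [add_mul]
      gcongr
      · exact hC2 h σ h0 h1 hp
      · exact hC3 h σ h0 h1 hp

/-- Taylor's formula for a chain of successive derivatives. -/
theorem norm_sub_taylor_le {h C : ℝ} (hh : 0 ≤ h) (J : ℕ) (g : ℕ → ℝ → ℂ)
    (hg : ∀ j, ∀ t ∈ Set.Icc 0 h, HasDerivAt (g j) (g (j + 1) t) t)
    (hC : ∀ t ∈ Set.Icc 0 h, ‖g J t‖ ≤ C) :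
    ‖g 0 h - ∑ j ∈ Finset.range J, (h : ℂ) ^ j / (j.factorial : ℂ) * g j 0‖ ≤ C * h ^ J := by
  induction J generalizing g h with
  | zero => simpa using hC h ⟨hh, le_rfl⟩
  | succ J ih =>
    have hC0 : 0 ≤ C := (norm_nonneg _).trans (hC 0 ⟨le_rfl, hh⟩)
    set r : ℝ → ℂ := fun t => g 0 t -
      ∑ j ∈ Finset.range (J + 1), (t : ℂ) ^ j / (j.factorial : ℂ) * g j 0 with hr
    have hd : ∀ t ∈ Set.Icc 0 h, HasDerivAt r (g 1 t -
        ∑ j ∈ Finset.range J, (t : ℂ) ^ j / (j.factorial : ℂ) * g (j + 1) 0) t := by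
      intro t ht
      refine (hg 0 t ht).sub ?_
      simp only [Finset.sum_range_succ' _ J, pow_zero, Nat.factorial_zero]
      refine HasDerivAt.add_const _ (HasDerivAt.fun_sum fun j _ => ?_)
      have := (((Complex.ofRealCLM.hasDerivAt (x := t)).pow (j + 1)).div_const
        ((j + 1).factorial : ℂ)).mul_const (g (j + 1) 0)
      convert! this using 1
      have h1 : ((j.factorial : ℂ)) ≠ 0 := by exact_mod_cast j.factorial_ne_zero
      have h2 : ((j : ℂ) + 1) ≠ 0 := by exact_mod_cast j.succ_ne_zero
      rw [Nat.factorial_succ]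
      push_cast
      simp
      field_simp
      simp
    have hb : ∀ t ∈ Set.Icc 0 h, ‖g 1 t -
        ∑ j ∈ Finset.range J, (t : ℂ) ^ j / (j.factorial : ℂ) * g (j + 1) 0‖ ≤ C * h ^ J := by
      intro t ht
      -- The derivative of the remainder is the remainder of order `J` for the shifted chain; the
      -- mean value inequality below then supplies the extra factor `h`.
      refine (ih ht.1 (fun j => g (j + 1)) (fun j s hs => hg _ s ⟨hs.1, hs.2.trans ht.2⟩)
        (fun s hs => hC s ⟨hs.1, hs.2.trans ht.2⟩)).trans ?_
      have := ht.1
      gcongr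
      exact ht.2
    have := (convex_Icc 0 h).norm_image_sub_le_of_norm_hasDerivWithin_le
      (fun t ht => (hd t ht).hasDerivWithinAt) hb (Set.left_mem_Icc.2 hh) (Set.right_mem_Icc.2 hh)
    have hr0 : r 0 = 0 := by
      simp [hr, Finset.sum_range_succ']
    rw [hr0, sub_zero, sub_zero, Real.norm_of_nonneg hh] at this
    rw [pow_succ, ← mul_assoc]
    exact this

/-! ### Sums over arithmetic progressions -/

theorem exists_bound_tsum_progression {c : ℝ} (hc : 0 < c) :
    ∃ S : ℝ, 0 ≤ S ∧ ∀ β : ℝ, Summable (fun n : ℤ => (1 + (c * (n + β)) ^ 2)⁻¹) ∧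
      ∑' n : ℤ, (1 + (c * (n + β)) ^ 2)⁻¹ ≤ S := by
  have hs0 : Summable fun n : ℤ => (1 + (n : ℝ) ^ 2)⁻¹ := by
    refine Summable.of_norm_bounded_eventually (g := fun n : ℤ => ((n : ℝ) ^ 2)⁻¹) ?_ ?_
    · simpa using (Real.summable_one_div_int_pow (p := 2)).2 one_lt_two
    · filter_upwards [(Set.finite_singleton (0 : ℤ)).compl_mem_cofinite] with n hn
      have : (0 : ℝ) < (n : ℝ) ^ 2 := by
        have : (n : ℝ) ≠ 0 := by exact_mod_cast hn
        positivity
      rw [Real.norm_of_nonneg (by positivity)]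
      gcongr
      linarith
  set κ := min 1 (c ^ 2) with hκ
  have hκ0 : 0 < κ := lt_min one_pos (by positivity)
  have key : ∀ β : ℝ, 0 ≤ β → β < 1 → ∀ n : ℤ,
      (1 + (c * (n + β)) ^ 2)⁻¹ ≤ 4 * κ⁻¹ * (1 + (n : ℝ) ^ 2)⁻¹ := by
    intro β h0 h1 n
    have h2 : κ * (1 + (n : ℝ) ^ 2) ≤ 4 * (1 + (c * (n + β)) ^ 2) := by
      have e1 : κ ≤ 1 := min_le_left _ _
      have e2 : κ ≤ c ^ 2 := min_le_right _ _
      have e3 : 1 + (n : ℝ) ^ 2 ≤ 4 * (1 + (n + β) ^ 2) := by nlinarith [sq_nonneg (n + 2 * β)]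
      have e4 : κ * (n + β) ^ 2 ≤ c ^ 2 * (n + β) ^ 2 := by gcongr
      nlinarith [mul_le_mul_of_nonneg_left e3 hκ0.le]
    rw [← div_eq_mul_inv, le_div_iff₀ (by positivity), inv_mul_le_iff₀ (by positivity),
      ← div_eq_mul_inv, ← mul_div_assoc, le_div_iff₀ hκ0]
    linarith
  have key2 : ∀ β : ℝ, 0 ≤ β → β < 1 → Summable (fun n : ℤ => (1 + (c * (n + β)) ^ 2)⁻¹) ∧
      ∑' n : ℤ, (1 + (c * (n + β)) ^ 2)⁻¹ ≤ ∑' n : ℤ, 4 * κ⁻¹ * (1 + (n : ℝ) ^ 2)⁻¹ := by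
    intro β h0 h1
    have : Summable (fun n : ℤ => (1 + (c * (n + β)) ^ 2)⁻¹) :=
      Summable.of_nonneg_of_le (fun n => by positivity) (key β h0 h1) (hs0.mul_left _)
    exact ⟨this, this.tsum_le_tsum (key β h0 h1) (hs0.mul_left _)⟩
  refine ⟨∑' n : ℤ, 4 * κ⁻¹ * (1 + (n : ℝ) ^ 2)⁻¹, tsum_nonneg fun n => by positivity,
    fun β => ?_⟩
  -- Shifting the summation index by `⌊β⌋` reduces to `0 ≤ β < 1`, whence the uniformity in `β`.
  have h := key2 (Int.fract β) (Int.fract_nonneg β) (Int.fract_lt_one β)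
  have e : (fun n : ℤ => (1 + (c * (n + β)) ^ 2)⁻¹) =
      (fun n : ℤ => (1 + (c * (n + Int.fract β)) ^ 2)⁻¹) ∘ Equiv.addRight ⌊β⌋ := by
    funext n
    simp only [Function.comp, Equiv.coe_addRight, Int.cast_add]
    congr 4
    rw [add_assoc, Int.floor_add_fract]
  rw [e, Equiv.summable_iff]
  refine ⟨h.1, ?_⟩
  exact ((Equiv.addRight ⌊β⌋).tsum_eq
    (fun n : ℤ => (1 + (c * (n + Int.fract β)) ^ 2)⁻¹)).trans_le h.2

/-- The point `σ = x + x² / (2 E N)` for `x = λ_n - E N`, extended to all integers `n`; these points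
form an arithmetic progression. -/
noncomputable def node (E : ℝ) (N : ℕ) (n : ℤ) : ℝ :=
  2 * Real.pi / E * (n + (1 / 2 - (E ^ 2 - 1) * N / (4 * Real.pi)))

theorem exists_bound_tsum_node {E : ℝ} (hE : 1 < E) :
    ∃ S : ℝ, 0 ≤ S ∧ ∀ N : ℕ, Summable (fun n : ℤ => (1 + node E N n ^ 2)⁻¹) ∧
      ∑' n : ℤ, (1 + node E N n ^ 2)⁻¹ ≤ S := by
  obtain ⟨S, hS, h⟩ := exists_bound_tsum_progression (c := 2 * Real.pi / E) (by positivity)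
  exact ⟨S, hS, fun N => h _⟩

theorem norm_le_of_schwartz (ψ : 𝓢(ℝ, ℂ)) :
    ∃ C : ℝ, 0 ≤ C ∧ ∀ x : ℝ, ‖ψ x‖ ≤ C * (1 + x ^ 2)⁻¹ := by
  obtain ⟨C, hC0, hC⟩ := exists_bound_schwartz ψ 2
  refine ⟨C, hC0, fun x => ?_⟩
  rw [← div_eq_mul_inv, le_div_iff₀ (by positivity), mul_comm]
  refine le_trans ?_ (hC x)
  gcongr
  nlinarith [abs_nonneg x, sq_abs x]

/-- Poisson summation on the progression `(2π/E)(n + β)`: the step gives the factor `E/(2π)`, and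
the offset gives `exp(2πikβ)`, which is `phase E N k`. -/
theorem hasSum_phase {E : ℝ} (hE : 1 < E) (N : ℕ) (ψ : 𝓢(ℝ, ℂ)) :
    HasSum (fun k : ℤ => (E / (2 * Real.pi) : ℂ) * (hat ψ (k * E) * phase E N k))
      (∑' n : ℤ, ψ (node E N n)) := by
  have hE0 : 0 < E := one_pos.trans hE
  have hpi := Real.pi_pos
  have hpic : (Real.pi : ℂ) ≠ 0 := by exact_mod_cast hpi.ne'
  have hEc : (E : ℂ) ≠ 0 := by exact_mod_cast hE0.ne'
  have hc : 2 * Real.pi / E ≠ 0 := by positivity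
  set β : ℝ := 1 / 2 - (E ^ 2 - 1) * N / (4 * Real.pi) with hβ
  set f : 𝓢(ℝ, ℂ) := SchwartzMap.compCLMOfContinuousLinearEquiv ℂ
    (ContinuousLinearEquiv.unitsEquivAut ℝ (Units.mk0 _ hc)) ψ with hf
  have hfx : ∀ x, f x = ψ (2 * Real.pi / E * x) := by
    intro x
    simp [hf, mul_comm]
  have hF : ∀ k : ℤ, FourierTransform.fourier (f : ℝ → ℂ) k =
      (E / (2 * Real.pi) : ℂ) * hat ψ (k * E) := by
    intro k
    rw [Real.fourier_real_eq_integral_exp_smul]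
    have := MeasureTheory.Measure.integral_comp_mul_left
      (fun x : ℝ => ψ x * Complex.exp (-(Complex.I * ((k * E : ℝ) : ℂ) * x))) (2 * Real.pi / E)
    rw [hat]
    rw [abs_of_pos (by positivity), Complex.real_smul] at this
    rw [show (E / (2 * Real.pi) : ℂ) = (((2 * Real.pi / E)⁻¹ : ℝ) : ℂ) by push_cast; field_simp,
      ← this]
    congr 1 with x
    rw [hfx, smul_eq_mul, mul_comm]
    congr 2
    push_cast
    field_simp
  have hph : ∀ k : ℤ, fourier k (β : UnitAddCircle) = phase E N k := by
    intro k
    rw [fourier_coe_apply, phase, ← Complex.exp_add, hβ]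
    congr 1
    push_cast
    field_simp
    ring
  have hP := SchwartzMap.tsum_eq_tsum_fourier f β
  rw [show (∑' n : ℤ, f (β + n)) = ∑' n : ℤ, ψ (node E N n) from
    tsum_congr fun n => by rw [hfx, node, add_comm]] at hP
  rw [hP]
  -- The Poisson formula equates only the values of `tsum`; summability comes from Schwartz decay.
  have : Summable fun k : ℤ => (FourierTransform.fourier f : 𝓢(ℝ, ℂ)) k *
      fourier k (β : UnitAddCircle) := by
    obtain ⟨C, hC0, hC⟩ := norm_le_of_schwartz (FourierTransform.fourier f : 𝓢(ℝ, ℂ))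
    obtain ⟨S, -, hS⟩ := exists_bound_tsum_progression one_pos
    have hS0 := (hS 0).1
    simp only [one_mul, add_zero] at hS0
    refine Summable.of_norm_bounded (hS0.mul_left C) fun k => ?_
    rw [norm_mul, fourier_apply, Circle.norm_coe, mul_one]
    exact hC k
  convert! this.hasSum using 1
  funext k
  rw [hph, SchwartzMap.fourier_coe, hF]
  ring

/-! ### The expansion of the sum over the Landau levels -/

/-- The coefficient of `N ^ (1 - j)` in the expansion. -/
noncomputable def coeff (E : ℝ) (φ : 𝓢(ℝ, ℂ)) (j N : ℕ) : ℂ :=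
  (j.factorial : ℂ)⁻¹ * ∑' n : ℤ, expansionOp (1 / (2 * E)) j 0 φ (node E N n)

theorem exists_bound_coeff {E : ℝ} (hE : 1 < E) (φ : 𝓢(ℝ, ℂ)) (j : ℕ) :
    ∃ M : ℝ, ∀ N : ℕ, ‖coeff E φ j N‖ ≤ M := by
  obtain ⟨C, hC0, hC⟩ := norm_le_of_schwartz (expansionOp (1 / (2 * E)) j 0 φ)
  obtain ⟨S, hS0, hS⟩ := exists_bound_tsum_node hE
  refine ⟨‖(j.factorial : ℂ)⁻¹‖ * (C * S), fun N => ?_⟩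
  rw [coeff, norm_mul]
  gcongr
  refine (tsum_of_norm_bounded ((hS N).1.mul_left C).hasSum fun n => hC _).trans ?_
  rw [tsum_mul_left]
  gcongr
  exact (hS N).2

theorem hasSum_coeff {E : ℝ} (hE : 1 < E) (φ : 𝓢(ℝ, ℂ)) (j N : ℕ) :
    HasSum (fun k : ℤ => (j.factorial : ℂ)⁻¹ * ((E / (2 * Real.pi) : ℂ) *
      (hat (expansionOp (1 / (2 * E)) j 0 φ) (k * E) * phase E N k))) (coeff E φ j N) :=
  (hasSum_phase hE N _).mul_left _

theorem exists_polynomial_hasSum_coeff {E : ℝ} (hE : 1 < E) :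
    ∃ P : ℕ → ℕ → Polynomial ℂ, ∀ (φ : 𝓢(ℝ, ℂ)) (j N : ℕ),
      HasSum (fun k : ℤ => (∑ m ∈ Finset.range (2 * j + 1),
        (P j m).eval (k : ℂ) * iteratedDeriv m (hat φ) (k * E)) * phase E N k)
        (coeff E φ j N) := by
  choose Q hQ using fun j => isFourierForm_expansionOp (1 / (2 * E)) j 0
  refine ⟨fun j m => Polynomial.C ((j.factorial : ℂ)⁻¹ * (E / (2 * Real.pi) : ℂ)) *
    (Q j m).comp (Polynomial.X * Polynomial.C (E : ℂ)), fun φ j N => ?_⟩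
  convert! hasSum_coeff hE φ j N using 1
  funext k
  have h := hQ j φ (k * E)
  simp only at h
  rw [h]
  simp only [Polynomial.eval_mul, Polynomial.eval_C, Polynomial.eval_comp, Polynomial.eval_X,
    Complex.ofReal_mul, Complex.ofReal_intCast, mul_assoc, ← Finset.mul_sum]

theorem hasSum_coeff_zero {E : ℝ} (hE : 1 < E) (φ : 𝓢(ℝ, ℂ)) (N : ℕ) :
    HasSum (fun k : ℤ => (E / (2 * Real.pi) : ℂ) * (hat φ (k * E) * phase E N k))
      (coeff E φ 0 N) := by
  simpa [expansionOp] using hasSum_coeff hE φ 0 N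

theorem hasSum_coeff_one {E : ℝ} (hE : 1 < E) (φ : 𝓢(ℝ, ℂ)) (N : ℕ) :
    HasSum (fun k : ℤ => (Complex.I / (2 * Real.pi) * deriv (hat φ) (k * E) +
      Complex.I * k * E / (4 * Real.pi) * iteratedDeriv 2 (hat φ) (k * E)) * phase E N k)
      (coeff E φ 1 N) := by
  convert! hasSum_coeff hE φ 1 N using 1
  funext k
  have hpic : (Real.pi : ℂ) ≠ 0 := by exact_mod_cast Real.pi_ne_zero
  have hEc : (E : ℂ) ≠ 0 := by exact_mod_cast (one_pos.trans hE).ne'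
  simp only [expansionOp, hat_neg, hat_smul, hat_add, hat_sqDeriv, iteratedDeriv_one]
  push_cast
  field_simp
  ring

/-- The `n`-th eigenvalue of the magnetic Laplacian, without multiplicity. -/
noncomputable def landauLevel (N : ℕ) (n : ℝ) : ℝ := 2 * Real.pi * N * (2 * n + 1)

theorem one_add_mul_node {E : ℝ} (hE : 1 < E) {N : ℕ} (hN : 1 ≤ N) (n : ℤ) :
    1 + 4 * (1 / (2 * E)) * (1 / N) * node E N n =
      (landauLevel N n + (N : ℝ) ^ 2) / (E * N) ^ 2 := by
  have hE0 : E ≠ 0 := (one_pos.trans hE).ne'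
  have hN0 : (N : ℝ) ≠ 0 := by positivity
  have := Real.pi_ne_zero
  rw [node, landauLevel]
  field_simp
  ring

/-- At `h = 1/N` the discriminant is `(λ_n/(EN))²`, and its nonnegative root `λ_n/(EN)` selects the
right solution of the quadratic equation. -/
theorem inv_node {E : ℝ} (hE : 1 < E) {N : ℕ} (hN : 1 ≤ N) {n : ℤ} (hn : 0 ≤ n) :
    inv (1 / (2 * E)) (1 / N) (node E N n) = √(landauLevel N n + (N : ℝ) ^ 2) - E * N := by
  have hE0 : 0 < E := one_pos.trans hE
  have hN0 : (0 : ℝ) < N := by positivity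
  have hn0 : (0 : ℝ) ≤ n := by exact_mod_cast hn
  have hl : 0 ≤ landauLevel N n + (N : ℝ) ^ 2 := by unfold landauLevel; positivity
  have h := one_add_mul_node hE hN n
  have h2 : node E N n = ((landauLevel N n + (N : ℝ) ^ 2) / (E * N) ^ 2 - 1) * (E * N) / 2 := by
    rw [← h]; field_simp; ring
  rw [inv, h, h2, Real.sqrt_div hl, Real.sqrt_sq (by positivity)]
  have hq := Real.sqrt_nonneg (landauLevel N n + (N : ℝ) ^ 2)
  have hq2 := Real.sq_sqrt hl
  set q := √(landauLevel N n + (N : ℝ) ^ 2)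
  rw [← hq2]
  field_simp
  ring

/-- The right side is affine in `t`, equal to `1` at `0` and to `(λ_n/(EN))² ≥ E⁻²` at `1/N`,
because `λ_n ≥ N`. -/
theorem inv_sq_le_one_add_mul_node {E : ℝ} (hE : 1 < E) {N : ℕ} (hN : 1 ≤ N) {n : ℤ}
    (hn : 0 ≤ n) {t : ℝ} (ht : t ∈ Set.Icc 0 (1 / (N : ℝ))) :
    E⁻¹ ^ 2 ≤ 1 + 4 * (1 / (2 * E)) * t * node E N n := by
  have hE0 : 0 < E := one_pos.trans hE
  have hN0 : (0 : ℝ) < N := by positivity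
  have hn0 : (0 : ℝ) ≤ n := by exact_mod_cast hn
  have h1 : E⁻¹ ^ 2 ≤ 1 + 4 * (1 / (2 * E)) * (1 / N) * node E N n := by
    rw [one_add_mul_node hE hN, le_div_iff₀ (by positivity)]
    have : 0 ≤ landauLevel N n := by unfold landauLevel; positivity
    field_simp
    linarith
  rcases le_total 0 (node E N n) with h | h
  · have : E⁻¹ ^ 2 ≤ 1 := pow_le_one₀ (by positivity) (inv_le_one_of_one_le₀ hE.le)
    have h3 : 0 ≤ 4 * (1 / (2 * E)) * t * node E N n := by
      have := ht.1
      positivity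
    linarith
  · have h3 : (1 / (N : ℝ)) * node E N n ≤ t * node E N n :=
      mul_le_mul_of_nonpos_right ht.2 h
    have h4 : 0 ≤ 4 * (1 / (2 * E)) := by positivity
    nlinarith [mul_le_mul_of_nonneg_left h3 h4]

theorem node_le_of_neg {E : ℝ} (hE : 1 < E) (N : ℕ) {n : ℤ} (hn : n < 0) :
    node E N n ≤ -((E ^ 2 - 1) / (2 * E) * N) := by
  have hE0 : 0 < E := one_pos.trans hE
  have hn0 : (n : ℝ) ≤ -1 := by exact_mod_cast Int.le_sub_one_of_lt hn
  have : -((E ^ 2 - 1) / (2 * E) * N) = 2 * Real.pi / E * -((E ^ 2 - 1) * N / (4 * Real.pi)) := by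
    field_simp; ring
  rw [this, node]
  gcongr
  linarith

theorem exists_bound_node_of_neg {E : ℝ} (hE : 1 < E) (ψ : 𝓢(ℝ, ℂ)) (J : ℕ) :
    ∃ C : ℝ, 0 ≤ C ∧ ∀ N : ℕ, 1 ≤ N → ∀ n : ℤ, n < 0 →
      ‖ψ (node E N n)‖ ≤ C * (1 / (N : ℝ)) ^ J * (1 + node E N n ^ 2)⁻¹ := by
  have hκ : 0 < (E ^ 2 - 1) / (2 * E) := div_pos (by nlinarith) (by linarith)
  set κ := (E ^ 2 - 1) / (2 * E)
  -- `J` powers of decay are traded for `N^(-J)`; the other two give summability over `n`.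
  obtain ⟨C, hC0, hC⟩ := exists_bound_schwartz ψ (J + 2)
  refine ⟨C * (κ ^ J)⁻¹, by positivity, fun N hN n hn => ?_⟩
  have hN0 : (0 : ℝ) < N := by positivity
  have h := node_le_of_neg hE N hn
  set x := node E N n
  have h1 : κ * N ≤ 1 + |x| := by linarith [neg_le_abs x]
  have h2 : 1 + x ^ 2 ≤ (1 + |x|) ^ 2 := by nlinarith [abs_nonneg x, sq_abs x]
  have h3 : (κ * N) ^ J ≤ (1 + |x|) ^ J := by gcongr
  have h4 : (κ * N) ^ J * (1 + x ^ 2) * ‖ψ x‖ ≤ C := by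
    refine le_trans ?_ (hC x)
    rw [pow_add]
    gcongr
  have e : C * (κ ^ J)⁻¹ * (1 / (N : ℝ)) ^ J * (1 + x ^ 2)⁻¹ =
      C / ((κ * N) ^ J * (1 + x ^ 2)) := by
    rw [mul_pow, one_div, inv_pow]; field_simp
  rw [e, le_div_iff₀ (by positivity)]
  linarith

/-- The sum over the Landau levels, extended by zero to all integers. -/
noncomputable def levelSummand (φ : 𝓢(ℝ, ℂ)) (E : ℝ) (N : ℕ) (n : ℤ) : ℂ :=
  if 0 ≤ n then φ (√(landauLevel N n + (N : ℝ) ^ 2) - E * N) else 0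

theorem exists_bound_remainder {E : ℝ} (hE : 1 < E) (φ : 𝓢(ℝ, ℂ)) (J : ℕ) :
    ∃ C : ℝ, 0 ≤ C ∧ ∀ N : ℕ, 1 ≤ N → ∀ n : ℤ,
      ‖levelSummand φ E N n - ∑ j ∈ Finset.range J, ((1 / N : ℝ) : ℂ) ^ j / (j.factorial : ℂ) *
        expansionOp (1 / (2 * E)) j 0 φ (node E N n)‖ ≤
      C * (1 / (N : ℝ)) ^ J * (1 + node E N n ^ 2)⁻¹ := by
  have hE0 : 0 < E := one_pos.trans hE
  obtain ⟨C, hC0, hC⟩ := exists_bound_paramDeriv (a := 1 / (2 * E)) (r := E⁻¹) (by positivity)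
    (by positivity) J 0 φ
  choose D hD0 hD using fun j => exists_bound_node_of_neg hE (expansionOp (1 / (2 * E)) j 0 φ) J
  refine ⟨C + ∑ j ∈ Finset.range J, D j, add_nonneg hC0 (Finset.sum_nonneg fun j _ => hD0 j),
    fun N hN n => ?_⟩
  have hN1 : (1 : ℝ) ≤ N := by exact_mod_cast hN
  have hh0 : 0 ≤ 1 / (N : ℝ) := by positivity
  have hh1 : 1 / (N : ℝ) ≤ 1 := by rw [div_le_one (by positivity)]; exact hN1
  rcases le_or_gt 0 n with hn | hn
  · have h := norm_sub_taylor_le (C := C * (1 + node E N n ^ 2)⁻¹) hh0 J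
      (fun j t => paramDeriv (1 / (2 * E)) j 0 φ t (node E N n))
      (fun j t ht => hasDerivAt_paramDeriv _ j 0 φ
        (lt_of_lt_of_le (by positivity) (inv_sq_le_one_add_mul_node hE hN hn ht)))
      (fun t ht => hC t _ ht.1 (ht.2.trans hh1) (inv_sq_le_one_add_mul_node hE hN hn ht))
    simp only [paramDeriv_zero_left] at h
    have e : paramDeriv (1 / (2 * E)) 0 0 φ (1 / N) (node E N n) = levelSummand φ E N n := by
      rw [paramDeriv, levelSummand, if_pos hn, inv_node hE hN hn, pow_zero, one_mul]
    rw [e] at h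
    refine h.trans ?_
    rw [mul_right_comm]
    gcongr
    exact le_add_of_nonneg_right (Finset.sum_nonneg fun j _ => hD0 j)
  · rw [levelSummand, if_neg hn.not_ge, zero_sub, norm_neg, add_mul, add_mul, Finset.sum_mul,
      Finset.sum_mul]
    refine (norm_sum_le _ _).trans (le_trans (Finset.sum_le_sum fun j _ => ?_)
      (le_add_of_nonneg_left (by positivity)))
    rw [norm_mul]
    refine le_trans ?_ (hD j N hN n hn)
    refine mul_le_of_le_one_left (norm_nonneg _) ?_
    rw [norm_div, norm_pow, Complex.norm_real, Complex.norm_natCast, Real.norm_of_nonneg hh0]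
    refine div_le_one_of_le₀ ((pow_le_one₀ hh0 hh1).trans ?_) (by positivity)
    exact_mod_cast j.factorial_pos

theorem summable_levelSummand {E : ℝ} (hE : 1 < E) (φ : 𝓢(ℝ, ℂ)) {N : ℕ} (hN : 1 ≤ N) :
    Summable (levelSummand φ E N) := by
  -- For `J = 0` the remainder is the summand itself.
  obtain ⟨C, -, hC⟩ := exists_bound_remainder hE φ 0
  obtain ⟨S, -, hS⟩ := exists_bound_tsum_node hE
  refine Summable.of_norm_bounded ((hS N).1.mul_left C) fun n => ?_
  simpa using hC N hN n

theorem exists_bound_expansion {E : ℝ} (hE : 1 < E) (φ : 𝓢(ℝ, ℂ)) (J : ℕ) :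
    ∃ C : ℝ, ∀ N : ℕ, 1 ≤ N →
      ‖N * ∑' n : ℤ, levelSummand φ E N n -
        ∑ j ∈ Finset.range J, coeff E φ j N * (N : ℂ) ^ (1 - (j : ℤ))‖ ≤
      C * (N : ℝ) ^ (1 - (J : ℤ)) := by
  obtain ⟨C, hC0, hC⟩ := exists_bound_remainder hE φ J
  obtain ⟨S, hS0, hS⟩ := exists_bound_tsum_node hE
  refine ⟨C * S, fun N hN => ?_⟩
  have hN0 : (N : ℝ) ≠ 0 := by positivity
  have hNc : (N : ℂ) ≠ 0 := by exact_mod_cast hN0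
  have hs : ∀ j, Summable fun n : ℤ => expansionOp (1 / (2 * E)) j 0 φ (node E N n) := by
    intro j
    obtain ⟨D, -, hD⟩ := norm_le_of_schwartz (expansionOp (1 / (2 * E)) j 0 φ)
    exact Summable.of_norm_bounded ((hS N).1.mul_left D) fun n => hD _
  have h1 := ((summable_levelSummand hE φ hN).hasSum.sub (hasSum_sum (s := Finset.range J)
    fun j _ => (hs j).hasSum.mul_left
      (((1 / N : ℝ) : ℂ) ^ j / (j.factorial : ℂ)))).mul_left (N : ℂ)
  have e : (N : ℂ) * ∑' n : ℤ, levelSummand φ E N n -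
        ∑ j ∈ Finset.range J, coeff E φ j N * (N : ℂ) ^ (1 - (j : ℤ)) =
      N * (∑' n : ℤ, levelSummand φ E N n - ∑ j ∈ Finset.range J,
        ((1 / N : ℝ) : ℂ) ^ j / (j.factorial : ℂ) *
          ∑' n : ℤ, expansionOp (1 / (2 * E)) j 0 φ (node E N n)) := by
    rw [mul_sub, Finset.mul_sum]
    congr 1
    refine Finset.sum_congr rfl fun j _ => ?_
    rw [coeff, zpow_sub₀ hNc, zpow_one, zpow_natCast,
      show ((1 / N : ℝ) : ℂ) ^ j = ((N : ℂ) ^ j)⁻¹ by push_cast; rw [one_div, inv_pow]]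
    field_simp
  rw [e, ← h1.tsum_eq]
  refine (tsum_of_norm_bounded (((hS N).1.mul_left (C * (1 / (N : ℝ)) ^ J)).mul_left
    (N : ℝ)).hasSum fun n => ?_).trans ?_
  · rw [norm_mul, Complex.norm_natCast]
    gcongr
    exact hC N hN n
  · rw [tsum_mul_left, tsum_mul_left, zpow_sub₀ hN0, zpow_one, zpow_natCast]
    have : C * S * ((N : ℝ) / (N : ℝ) ^ J) = N * (C * (1 / (N : ℝ)) ^ J * S) := by
      rw [one_div, inv_pow]; ring
    rw [this]
    gcongr
    exact (hS N).2

/-! ### The ladder operators -/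

theorem covY_apply {N : ℕ} (u : Section N) (p : ℝ × ℝ) :
    (covY N u : ℝ × ℝ → ℂ) p = fderiv ℝ (u : ℝ × ℝ → ℂ) p (0, 1) -
      2 * Real.pi * Complex.I * N * (p.1 : ℝ) * (u : ℝ × ℝ → ℂ) p := rfl

/-- The curvature identity: second derivatives commute, and only the derivative of the coefficient
`x` of the connection survives. -/
theorem covX_covY {N : ℕ} (u : Section N) :
    covX N (covY N u) = covY N (covX N u) - (2 * Real.pi * Complex.I * N : ℂ) • u := by
  ext p
  have hdu : Differentiable ℝ (fderiv ℝ (u : ℝ × ℝ → ℂ)) :=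
    (u.2.1.fderiv_right (m := ∞) (by simp)).differentiable (by simp)
  have hsymm : IsSymmSndFDerivAt ℝ (u : ℝ × ℝ → ℂ) p :=
    u.2.1.contDiffAt.isSymmSndFDerivAt
      (by simpa using WithTop.coe_le_coe.2 (le_top : (2 : ℕ∞) ≤ ⊤))
  have h1 : ∀ v : ℝ × ℝ, HasFDerivAt (fun p => fderiv ℝ (u : ℝ × ℝ → ℂ) p v)
      ((fderiv ℝ (fderiv ℝ (u : ℝ × ℝ → ℂ)) p).flip v) p := fun v => by
    simpa using! (hdu p).hasFDerivAt.clm_apply (hasFDerivAt_const v p)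
  have h3 : HasFDerivAt (fun q : ℝ × ℝ => (2 * Real.pi * Complex.I * N * (q.1 : ℝ) : ℂ))
      ((2 * Real.pi * Complex.I * N : ℂ) •
        (Complex.ofRealCLM.comp (ContinuousLinearMap.fst ℝ ℝ ℝ))) p :=
    (Complex.ofRealCLM.comp (ContinuousLinearMap.fst ℝ ℝ ℝ)).hasFDerivAt.const_mul _
  have h4 := (h1 (0, 1)).sub (h3.mul (Section.differentiable u p).hasFDerivAt)
  have e1 : (covX N (covY N u) : ℝ × ℝ → ℂ) p = _ :=
    congrArg (fun T : ℝ × ℝ →L[ℝ] ℂ => T (1, 0)) h4.fderiv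
  have e2 : (covY N (covX N u) : ℝ × ℝ → ℂ) p =
      ((fderiv ℝ (fderiv ℝ (u : ℝ × ℝ → ℂ)) p).flip (1, 0)) (0, 1) -
      2 * Real.pi * Complex.I * N * (p.1 : ℝ) * fderiv ℝ (u : ℝ × ℝ → ℂ) p (1, 0) := by
    rw [covY_apply, ← (h1 (1, 0)).fderiv]; rfl
  have e3 := hsymm.eq (1, 0) (0, 1)
  rw [e1]
  simp only [Submodule.coe_sub, Submodule.coe_smul, Pi.sub_apply, Pi.smul_apply, e2]
  simp [e3]
  ring

/-- The magnetic field strength of `L^N`. -/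
noncomputable def field (N : ℕ) : ℂ := 2 * Real.pi * N

section Ladder

variable {V : Type*} [AddCommGroup V] [Module ℂ V]

/-- The annihilation operator `X + i Y`. -/
noncomputable def lowering (X Y : Module.End ℂ V) : Module.End ℂ V := X + Complex.I • Y

/-- The creation operator `X - i Y`. -/
noncomputable def raising (X Y : Module.End ℂ V) : Module.End ℂ V := X - Complex.I • Y

/-- The operator `-(X² + Y²)`. -/
noncomputable def bochner (X Y : Module.End ℂ V) : Module.End ℂ V := -(X * X + Y * Y)

variable {X Y : Module.End ℂ V} {b : ℂ}

theorem raising_mul_lowering (h : X * Y = Y * X - (Complex.I * b) • 1) :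
    raising X Y * lowering X Y = b • 1 - bochner X Y := by
  rw [raising, lowering, bochner, sub_mul, mul_add, mul_add, mul_smul_comm,
    smul_mul_assoc, smul_mul_assoc, mul_smul_comm, h, smul_smul, smul_sub, smul_smul,
    ← mul_assoc, Complex.I_mul_I]
  module

theorem lowering_mul_raising (h : X * Y = Y * X - (Complex.I * b) • 1) :
    lowering X Y * raising X Y = -b • 1 - bochner X Y := by
  rw [raising, lowering, bochner, add_mul, mul_sub, mul_sub, mul_smul_comm,
    smul_mul_assoc, smul_mul_assoc, mul_smul_comm, h, smul_smul, smul_sub, smul_smul,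
    ← mul_assoc, Complex.I_mul_I]
  module

open Module.End

/-- The two orders of the product of ladder operators are `b - Δ` and `-b - Δ`; comparing them
yields the commutator of `Δ` with `lowering`. -/
theorem lowering_mem (h : X * Y = Y * X - (Complex.I * b) • 1) {μ : ℂ} {u : V}
    (hu : u ∈ eigenspace (bochner X Y) μ) :
    lowering X Y u ∈ eigenspace (bochner X Y) (μ - 2 * b) := by
  rw [mem_eigenspace_iff] at hu ⊢
  have e1 := raising_mul_lowering h
  have e2 := lowering_mul_raising h
  have h1 : bochner X Y * lowering X Y =
      lowering X Y * bochner X Y - (2 * b) • lowering X Y := by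
    conv_lhs => rw [← sub_eq_iff_eq_add.2 (sub_eq_iff_eq_add'.1 e2.symm), sub_mul, mul_assoc, e1]
    simp only [mul_sub, smul_mul_assoc, mul_smul_comm, one_mul, mul_one]
    module
  have h2 := LinearMap.congr_fun h1 u
  simp only [mul_apply, LinearMap.sub_apply, LinearMap.smul_apply, hu, map_smul] at h2
  rw [h2, sub_smul]

theorem raising_mem (h : X * Y = Y * X - (Complex.I * b) • 1) {μ : ℂ} {u : V}
    (hu : u ∈ eigenspace (bochner X Y) (μ - 2 * b)) :
    raising X Y u ∈ eigenspace (bochner X Y) μ := by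
  rw [mem_eigenspace_iff] at hu ⊢
  have e1 := raising_mul_lowering h
  have e2 := lowering_mul_raising h
  have h1 : bochner X Y * raising X Y =
      raising X Y * bochner X Y + (2 * b) • raising X Y := by
    conv_lhs => rw [← sub_eq_iff_eq_add.2 (sub_eq_iff_eq_add'.1 e1.symm), sub_mul, mul_assoc, e2]
    simp only [mul_sub, smul_mul_assoc, mul_smul_comm, one_mul, mul_one]
    module
  have h2 := LinearMap.congr_fun h1 u
  simp only [mul_apply, LinearMap.add_apply, LinearMap.smul_apply, hu, map_smul] at h2
  rw [h2, ← add_smul, sub_add_cancel]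

theorem raising_lowering_apply (h : X * Y = Y * X - (Complex.I * b) • 1) {μ : ℂ} {u : V}
    (hu : u ∈ eigenspace (bochner X Y) μ) :
    raising X Y (lowering X Y u) = (b - μ) • u := by
  have := LinearMap.congr_fun (raising_mul_lowering h) u
  rw [mem_eigenspace_iff] at hu
  simp only [mul_apply, LinearMap.sub_apply, LinearMap.smul_apply, hu, one_apply] at this
  rw [this, sub_smul]

theorem lowering_raising_apply (h : X * Y = Y * X - (Complex.I * b) • 1) {μ : ℂ} {u : V}
    (hu : u ∈ eigenspace (bochner X Y) (μ - 2 * b)) :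
    lowering X Y (raising X Y u) = (b - μ) • u := by
  have := LinearMap.congr_fun (lowering_mul_raising h) u
  rw [mem_eigenspace_iff] at hu
  simp only [mul_apply, LinearMap.sub_apply, LinearMap.smul_apply, hu, one_apply] at this
  rw [this]
  module

theorem mem_eigenspace_of_lowering_eq_zero (h : X * Y = Y * X - (Complex.I * b) • 1) {u : V}
    (hu : lowering X Y u = 0) : u ∈ eigenspace (bochner X Y) b := by
  have := LinearMap.congr_fun (raising_mul_lowering h) u
  simp only [mul_apply, LinearMap.sub_apply, LinearMap.smul_apply, hu, map_zero,
    one_apply] at this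
  rw [mem_eigenspace_iff]
  exact (sub_eq_zero.1 this.symm).symm

/-- Between these eigenspaces `raising` and `lowering` compose, in both orders, to the scalar `b -
μ`, which is nonzero. -/
theorem rank_eigenspace_bochner_sub (h : X * Y = Y * X - (Complex.I * b) • 1) {μ : ℂ}
    (hμ : μ ≠ b) : Module.rank ℂ (eigenspace (bochner X Y) μ) =
      Module.rank ℂ (eigenspace (bochner X Y) (μ - 2 * b)) := by
  have hne : b - μ ≠ 0 := sub_ne_zero.2 hμ.symm
  refine LinearEquiv.rank_eq (LinearEquiv.ofBijective
    ((lowering X Y).restrict fun u hu => lowering_mem h hu) ⟨?_, ?_⟩)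
  · rw [injective_iff_map_eq_zero]
    intro u hu
    have h1 : lowering X Y (u : V) = 0 := congrArg Subtype.val hu
    have h2 := raising_lowering_apply h u.2
    rw [h1, map_zero] at h2
    exact Subtype.ext ((smul_eq_zero.1 h2.symm).resolve_left hne)
  · intro v
    refine ⟨(b - μ)⁻¹ • ⟨raising X Y v, raising_mem h v.2⟩, Subtype.ext ?_⟩
    simp [LinearMap.restrict_apply, lowering_raising_apply h v.2, hne]

end Ladder

theorem commutator_covX_covY (N : ℕ) : (covX N * covY N : Module.End ℂ (Section N)) =
    covY N * covX N - (Complex.I * field N) • 1 := by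
  ext1 u
  refine (covX_covY u).trans ?_
  rw [show (2 * Real.pi * Complex.I * N : ℂ) = Complex.I * field N by rw [field]; ring]
  rfl

theorem magneticLaplacian_eq (N : ℕ) : magneticLaplacian N = bochner (covX N) (covY N) := rfl

theorem rank_eigenspace_sub {N : ℕ} {μ : ℂ} (hμ : μ ≠ field N) :
    Module.rank ℂ (Module.End.eigenspace (magneticLaplacian N) μ) =
      Module.rank ℂ (Module.End.eigenspace (magneticLaplacian N) (μ - 2 * field N)) :=
  rank_eigenspace_bochner_sub (commutator_covX_covY N) hμ

/-! ### Positivity -/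

/-- If `c > 0`, the second derivative test makes `0` a local minimum as well; then `p` is locally
constant and `c = 0`. -/
theorem deriv_deriv_nonpos_of_isMax {p p' : ℝ → ℝ} {c : ℝ} (h1 : ∀ t, HasDerivAt p (p' t) t)
    (h2 : HasDerivAt p' c 0) (hmax : ∀ t, p t ≤ p 0) : c ≤ 0 := by
  by_contra! hc
  have e1 : deriv p = p' := funext fun t => (h1 t).deriv
  have hloc : IsLocalMax p 0 := Eventually.of_forall hmax
  have hmin := isLocalMin_of_deriv_deriv_pos (f := p) (x₀ := 0) (by rw [e1, h2.deriv]; exact hc)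
    hloc.deriv_eq_zero (h1 0).continuousAt
  have hconst : p =ᶠ[𝓝 0] fun _ => p 0 :=
    hmin.mono fun t ht => le_antisymm (hmax t) ht
  have h3 := hconst.deriv.deriv_eq
  rw [e1, h2.deriv] at h3
  simp at h3
  exact hc.ne' h3

theorem re_conj_mul_nonpos_of_isMax {f f' : ℝ → ℂ} {c : ℂ} (h1 : ∀ t, HasDerivAt f (f' t) t)
    (h2 : HasDerivAt f' c 0) (hmax : ∀ t, ‖f t‖ ≤ ‖f 0‖) : (starRingEnd ℂ (f 0) * c).re ≤ 0 := by
  have key : ∀ {g : ℝ → ℂ} {g' : ℂ} {t : ℝ}, HasDerivAt g g' t →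
      HasDerivAt (fun t => (starRingEnd ℂ (f 0) * g t).re) (starRingEnd ℂ (f 0) * g').re t :=
    fun h => Complex.reCLM.hasFDerivAt.comp_hasDerivAt _ (h.const_mul (starRingEnd ℂ (f 0)))
  refine deriv_deriv_nonpos_of_isMax (fun t => key (h1 t)) (key h2) fun t => ?_
  refine (Complex.re_le_norm _).trans ?_
  rw [norm_mul, RCLike.norm_conj, mul_comm (starRingEnd ℂ (f 0)), Complex.mul_conj,
    Complex.ofReal_re, Complex.normSq_eq_norm_sq, sq]
  exact mul_le_mul_of_nonneg_left (hmax t) (norm_nonneg _)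

theorem norm_shift_x {N : ℕ} (u : Section N) (x y : ℝ) :
    ‖(u : ℝ × ℝ → ℂ) (x + 1, y)‖ = ‖(u : ℝ × ℝ → ℂ) (x, y)‖ := by
  rw [u.2.2.1, norm_mul, show (2 * Real.pi * Complex.I * N * y : ℂ) =
    ((2 * Real.pi * N * y : ℝ) : ℂ) * Complex.I by push_cast; ring,
    Complex.norm_exp_ofReal_mul_I, one_mul]

theorem exists_forall_norm_le {N : ℕ} (u : Section N) :
    ∃ p, ∀ q, ‖(u : ℝ × ℝ → ℂ) q‖ ≤ ‖(u : ℝ × ℝ → ℂ) p‖ := by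
  obtain ⟨p, -, hp⟩ := (isCompact_Icc (a := ((0, 0) : ℝ × ℝ)) (b := (1, 1))).exists_isMaxOn
    ⟨(0, 0), by simp⟩ (f := fun q => ‖(u : ℝ × ℝ → ℂ) q‖) u.2.1.continuous.norm.continuousOn
  refine ⟨p, fun q => ?_⟩
  have hx : ∀ y, Function.Periodic (fun x => ‖(u : ℝ × ℝ → ℂ) (x, y)‖) 1 :=
    fun y x => norm_shift_x u x y
  have hy : ∀ x, Function.Periodic (fun y => ‖(u : ℝ × ℝ → ℂ) (x, y)‖) 1 :=
    fun x y => by simp only [u.2.2.2]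
  have e : ‖(u : ℝ × ℝ → ℂ) q‖ = ‖(u : ℝ × ℝ → ℂ) (Int.fract q.1, Int.fract q.2)‖ := by
    have h1 := (hx q.2).sub_int_mul_eq (x := q.1) ⌊q.1⌋
    have h2 := (hy (Int.fract q.1)).sub_int_mul_eq (x := q.2) ⌊q.2⌋
    simp only [mul_one, Int.self_sub_floor] at h1 h2
    rw [h2, h1]
  rw [e]
  exact hp ⟨⟨Int.fract_nonneg _, Int.fract_nonneg _⟩,
    ⟨(Int.fract_lt_one _).le, (Int.fract_lt_one _).le⟩⟩

theorem hasDerivAt_line_x {N : ℕ} (u : Section N) (p : ℝ × ℝ) (t : ℝ) :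
    HasDerivAt (fun t => (u : ℝ × ℝ → ℂ) (p.1 + t, p.2))
      ((covX N u : ℝ × ℝ → ℂ) (p.1 + t, p.2)) t := by
  have h := (Section.differentiable u (p.1 + t, p.2)).hasFDerivAt
  exact h.comp_hasDerivAt t (((hasDerivAt_id t).const_add p.1).prodMk (hasDerivAt_const t p.2))

/-- A gauge factor of modulus one turns `∇_y` into an ordinary derivative along a vertical line, so
the maximum of the norm is unaffected. -/
theorem hasDerivAt_line_y {N : ℕ} (u : Section N) (p : ℝ × ℝ) (t : ℝ) :
    HasDerivAt (fun t : ℝ => Complex.exp (-(2 * Real.pi * Complex.I * N * (p.1 : ℝ)) * t) *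
        (u : ℝ × ℝ → ℂ) (p.1, p.2 + t))
      (Complex.exp (-(2 * Real.pi * Complex.I * N * (p.1 : ℝ)) * t) *
        (covY N u : ℝ × ℝ → ℂ) (p.1, p.2 + t)) t := by
  have h := (Section.differentiable u (p.1, p.2 + t)).hasFDerivAt
  have h1 := h.comp_hasDerivAt t
    ((hasDerivAt_const t p.1).prodMk ((hasDerivAt_id t).const_add p.2))
  have h2 := ((Complex.ofRealCLM.hasDerivAt (x := t)).const_mul
    (-(2 * Real.pi * Complex.I * N * (p.1 : ℝ)))).cexp
  convert! h2.mul h1 using 1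
  simp only [covY_apply, Complex.ofRealCLM_apply, Complex.ofReal_one, mul_one,
    Function.comp_apply, id_eq]
  ring

/-- At a maximum point of `‖u‖` both `Re(ū ∇_x²u)` and `Re(ū ∇_y²u)` are nonpositive, so `Re μ ·
|u|² ≥ 0` there. Negative `Re μ` forces the maximum to vanish. -/
theorem eigenspace_eq_bot_of_re_neg {N : ℕ} {μ : ℂ} (hμ : μ.re < 0) :
    Module.End.eigenspace (magneticLaplacian N) μ = ⊥ := by
  rw [eq_bot_iff]
  intro u hu
  rw [Module.End.mem_eigenspace_iff] at hu
  obtain ⟨p, hp⟩ := exists_forall_norm_le u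
  have hX := re_conj_mul_nonpos_of_isMax (hasDerivAt_line_x u p) (hasDerivAt_line_x (covX N u) p 0)
    (fun t => by simpa using hp _)
  have hY := re_conj_mul_nonpos_of_isMax (hasDerivAt_line_y u p) (hasDerivAt_line_y (covY N u) p 0)
    (fun t => by
      rw [norm_mul, show -(2 * Real.pi * Complex.I * N * (p.1 : ℝ)) * (t : ℂ) =
        ((-(2 * Real.pi * N * p.1 * t) : ℝ) : ℂ) * Complex.I by push_cast; ring,
        Complex.norm_exp_ofReal_mul_I]
      simpa using hp _)
  simp only [add_zero, Complex.ofReal_zero, mul_zero, Complex.exp_zero, one_mul, Prod.mk.eta]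
    at hX hY
  have h : -((covX N (covX N u) : ℝ × ℝ → ℂ) p + (covY N (covY N u) : ℝ × ℝ → ℂ) p) =
      μ * (u : ℝ × ℝ → ℂ) p := congrFun (congrArg Subtype.val hu) p
  have h2 : starRingEnd ℂ ((u : ℝ × ℝ → ℂ) p) * (covX N (covX N u) : ℝ × ℝ → ℂ) p +
      starRingEnd ℂ ((u : ℝ × ℝ → ℂ) p) * (covY N (covY N u) : ℝ × ℝ → ℂ) p =
      -(μ * Complex.normSq ((u : ℝ × ℝ → ℂ) p)) := by
    rw [← Complex.mul_conj]
    linear_combination -(starRingEnd ℂ ((u : ℝ × ℝ → ℂ) p)) * h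
  have h3 := congrArg Complex.re h2
  rw [Complex.add_re, Complex.neg_re, Complex.re_mul_ofReal] at h3
  have h4 : Complex.normSq ((u : ℝ × ℝ → ℂ) p) = 0 := by
    have := Complex.normSq_nonneg ((u : ℝ × ℝ → ℂ) p)
    nlinarith
  have h5 : (u : ℝ × ℝ → ℂ) p = 0 := Complex.normSq_eq_zero.1 h4
  refine (Submodule.mem_bot ℂ).2 (Subtype.ext (funext fun q => ?_))
  have := hp q
  rw [h5, norm_zero] at this
  exact norm_le_zero_iff.1 this

/-- Landau levels: the `n`-th level has the multiplicity of the lowest one. -/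
theorem rank_eigenspace_level (N : ℕ) (hN : 1 ≤ N) (n : ℕ) :
    Module.rank ℂ (Module.End.eigenspace (magneticLaplacian N) ((2 * n + 1) * field N)) =
      Module.rank ℂ (Module.End.eigenspace (magneticLaplacian N) (field N)) := by
  have hf : field N ≠ 0 := by
    have : (Real.pi : ℂ) ≠ 0 := by exact_mod_cast Real.pi_ne_zero
    have : (N : ℂ) ≠ 0 := by exact_mod_cast (by omega : N ≠ 0)
    simp [field, *]
  induction n with
  | zero => rw [Nat.cast_zero, mul_zero, zero_add, one_mul]
  | succ n ih =>
    rw [rank_eigenspace_sub, ← ih, show (2 * ((n + 1 : ℕ) : ℂ) + 1) * field N - 2 * field N =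
      (2 * n + 1) * field N by push_cast; ring]
    · intro h
      have h1 : (2 * ((n : ℂ) + 1)) * field N = 0 := by
        push_cast at h
        linear_combination h
      have h2 : (n : ℂ) + 1 ≠ 0 := by exact_mod_cast n.succ_ne_zero
      simp [hf, h2] at h1

/-- Away from the levels, descending by `2 * field N` never meets `field N`, so the rank is
preserved until the real part is negative. -/
theorem rank_eigenspace_eq_zero (N : ℕ) (hN : 1 ≤ N) {μ : ℂ}
    (hμ : ∀ n : ℕ, μ ≠ (2 * n + 1) * field N) :
    Module.rank ℂ (Module.End.eigenspace (magneticLaplacian N) μ) = 0 := by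
  have hpos : 0 < 2 * Real.pi * N := by positivity
  have key : ∀ k : ℕ, Module.rank ℂ (Module.End.eigenspace (magneticLaplacian N) μ) =
      Module.rank ℂ (Module.End.eigenspace (magneticLaplacian N) (μ - 2 * k * field N)) := by
    intro k
    induction k with
    | zero => rw [Nat.cast_zero, mul_zero, zero_mul, sub_zero]
    | succ k ih =>
      rw [ih, rank_eigenspace_sub, show μ - 2 * k * field N - 2 * field N =
        μ - 2 * ((k + 1 : ℕ) : ℂ) * field N by push_cast; ring]
      · intro h
        exact hμ k (by linear_combination h)
  obtain ⟨k, hk⟩ := exists_nat_gt (μ.re / (2 * (2 * Real.pi * N)))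
  rw [key k, eigenspace_eq_bot_of_re_neg, rank_bot]
  rw [div_lt_iff₀ (by positivity)] at hk
  have : (2 * k * field N : ℂ) = ((2 * k * (2 * Real.pi * N) : ℝ) : ℂ) := by
    rw [field]; push_cast; ring
  rw [this, Complex.sub_re, Complex.ofReal_re]
  linarith

theorem lowering_apply {N : ℕ} (u : Section N) (p : ℝ × ℝ) :
    (lowering (covX N) (covY N) u : ℝ × ℝ → ℂ) p =
      (covX N u : ℝ × ℝ → ℂ) p + Complex.I * (covY N u : ℝ × ℝ → ℂ) p := rfl

/-- Lowering would produce an eigenvector with the negative eigenvalue `-field N`. -/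
theorem mem_eigenspace_field_iff {N : ℕ} (hN : 1 ≤ N) (u : Section N) :
    u ∈ Module.End.eigenspace (magneticLaplacian N) (field N) ↔
      lowering (covX N) (covY N) u = 0 := by
  refine ⟨fun hu => ?_, mem_eigenspace_of_lowering_eq_zero (commutator_covX_covY N)⟩
  have h := lowering_mem (commutator_covX_covY N) hu
  rw [← magneticLaplacian_eq, eigenspace_eq_bot_of_re_neg] at h
  · simpa using h
  · have : 0 < 2 * Real.pi * N := by positivity
    have e : field N - 2 * field N = ((-(2 * Real.pi * N) : ℝ) : ℂ) := by
      rw [field]; push_cast; ring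
    rw [e, Complex.ofReal_re]
    linarith

/-! ### The lowest Landau level: upper bound for the dimension -/

theorem hasDerivAt_integral_of_continuous {F F' : ℝ → ℝ → ℂ}
    (hF : Continuous (Function.uncurry F)) (hF' : Continuous (Function.uncurry F'))
    (hd : ∀ x y, HasDerivAt (fun x => F x y) (F' x y) x) (a b x : ℝ) :
    HasDerivAt (fun x => ∫ y in a..b, F x y) (∫ y in a..b, F' x y) x := by
  obtain ⟨C, hC⟩ := ((isCompact_Icc (a := x - 1) (b := x + 1)).prod
    (isCompact_uIcc (a := a) (b := b))).exists_bound_of_continuousOn hF'.continuousOn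
  have hc : ∀ x, Continuous (F x) := fun x => hF.comp (by fun_prop : Continuous fun y => (x, y))
  have hc' : ∀ x, Continuous (F' x) := fun x =>
    hF'.comp (by fun_prop : Continuous fun y => (x, y))
  refine (intervalIntegral.hasDerivAt_integral_of_dominated_loc_of_deriv_le
    (s := Set.Icc (x - 1) (x + 1)) (bound := fun _ => C)
    (Icc_mem_nhds (by linarith) (by linarith))
    (Eventually.of_forall fun x => (hc x).aestronglyMeasurable) ((hc x).intervalIntegrable _ _)
    (hc' x).aestronglyMeasurable
    (Eventually.of_forall fun t ht s hs => hC (s, t) ⟨hs, Set.uIoc_subset_uIcc ht⟩)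
    (by simp) (Eventually.of_forall fun t _ s _ => hd s t)).2

/-- The Fourier coefficients of a section in the variable `y`. -/
noncomputable def yCoeff {N : ℕ} (u : Section N) (m : ℤ) (x : ℝ) : ℂ :=
  ∫ y in (0 : ℝ)..1, Complex.exp (-(2 * Real.pi * Complex.I * m * y)) * (u : ℝ × ℝ → ℂ) (x, y)

theorem hasDerivAt_yCoeff {N : ℕ} (u : Section N) (m : ℤ) (x : ℝ) :
    HasDerivAt (yCoeff u m) (yCoeff (covX N u) m x) x := by
  have hu := u.2.1.continuous
  have hXu := (covX N u).2.1.continuous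
  refine hasDerivAt_integral_of_continuous
    (F := fun x y => Complex.exp (-(2 * Real.pi * Complex.I * m * y)) * (u : ℝ × ℝ → ℂ) (x, y))
    (F' := fun x y => Complex.exp (-(2 * Real.pi * Complex.I * m * y)) *
      (covX N u : ℝ × ℝ → ℂ) (x, y)) ?_ ?_ (fun x y => ?_) 0 1 x
  · exact Continuous.mul (by fun_prop) hu
  · exact Continuous.mul (by fun_prop) hXu
  · simpa using (hasDerivAt_line_x u (0, y) x).const_mul
      (Complex.exp (-(2 * Real.pi * Complex.I * m * y)))

/-- Integration by parts over a period in `y`; the boundary terms cancel. -/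
theorem yCoeff_covY {N : ℕ} (u : Section N) (m : ℤ) (x : ℝ) :
    yCoeff (covY N u) m x =
      (2 * Real.pi * Complex.I * m - 2 * Real.pi * Complex.I * N * x) * yCoeff u m x := by
  have hu := u.2.1.continuous
  have hYu := (covY N u).2.1.continuous
  have hu' : Continuous fun y : ℝ => (u : ℝ × ℝ → ℂ) (x, y) := by fun_prop
  have hYu' : Continuous fun y : ℝ => (covY N u : ℝ × ℝ → ℂ) (x, y) := by fun_prop
  have hd : ∀ y : ℝ, HasDerivAt
      (fun y : ℝ => Complex.exp (-(2 * Real.pi * Complex.I * m * y)) * (u : ℝ × ℝ → ℂ) (x, y))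
      (Complex.exp (-(2 * Real.pi * Complex.I * m * y)) * (covY N u : ℝ × ℝ → ℂ) (x, y) -
        (2 * Real.pi * Complex.I * m - 2 * Real.pi * Complex.I * N * x) *
        (Complex.exp (-(2 * Real.pi * Complex.I * m * y)) * (u : ℝ × ℝ → ℂ) (x, y))) y := by
    intro y
    have h1 := ((Section.differentiable u (x, y)).hasFDerivAt).comp_hasDerivAt y
      ((hasDerivAt_const y x).prodMk (hasDerivAt_id y))
    have h2 := ((Complex.ofRealCLM.hasDerivAt (x := y)).const_mul
      (2 * Real.pi * Complex.I * m)).neg.cexp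
    convert! h2.mul h1 using 1
    simp only [covY_apply, Complex.ofRealCLM_apply, Complex.ofReal_one, mul_one,
      Function.comp_apply, Pi.neg_apply]
    ring
  have h := intervalIntegral.integral_eq_sub_of_hasDerivAt (a := 0) (b := 1) (fun y _ => hd y)
    (Continuous.intervalIntegrable (by fun_prop) _ _)
  rw [intervalIntegral.integral_sub (Continuous.intervalIntegrable (by fun_prop) _ _)
    (Continuous.intervalIntegrable (by fun_prop) _ _), intervalIntegral.integral_const_mul] at h
  have h0 : (u : ℝ × ℝ → ℂ) (x, 1) = (u : ℝ × ℝ → ℂ) (x, 0) := by simpa using u.2.2.2 x 0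
  have h1 : Complex.exp (-(2 * Real.pi * Complex.I * m)) = 1 :=
    Complex.exp_eq_one_iff.2 ⟨-m, by push_cast; ring⟩
  simp only [h0, Complex.ofReal_one, mul_one, h1, Complex.ofReal_zero, mul_zero, neg_zero,
    Complex.exp_zero, sub_self] at h
  exact sub_eq_zero.1 h

theorem yCoeff_add {N : ℕ} (u v : Section N) (m : ℤ) (x : ℝ) :
    yCoeff (u + v) m x = yCoeff u m x + yCoeff v m x := by
  have hu := u.2.1.continuous
  have hv := v.2.1.continuous
  rw [yCoeff, yCoeff, yCoeff, ← intervalIntegral.integral_add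
    (Continuous.intervalIntegrable (by fun_prop) _ _)
    (Continuous.intervalIntegrable (by fun_prop) _ _)]
  congr 1 with y
  exact mul_add _ _ _

theorem yCoeff_smul {N : ℕ} (a : ℂ) (u : Section N) (m : ℤ) (x : ℝ) :
    yCoeff (a • u) m x = a * yCoeff u m x := by
  rw [yCoeff, yCoeff, ← intervalIntegral.integral_const_mul]
  congr 1 with y
  exact mul_left_comm _ _ _

theorem yCoeff_add_one {N : ℕ} (u : Section N) (m : ℤ) (x : ℝ) :
    yCoeff u m (x + 1) = yCoeff u (m - N) x := by
  rw [yCoeff, yCoeff]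
  congr 1 with y
  rw [u.2.2.1, ← mul_assoc, ← Complex.exp_add]
  congr 2
  push_cast
  ring

/-- The equation `∇_x u = -i ∇_y u` becomes the linear equation `c' = 2π(m - Nx)c` for each Fourier
coefficient. -/
theorem yCoeff_eq {N : ℕ} {u : Section N} (hu : lowering (covX N) (covY N) u = 0) (m : ℤ)
    (x : ℝ) : yCoeff u m x =
      yCoeff u m 0 * Complex.exp (2 * Real.pi * m * x - Real.pi * N * x ^ 2) := by
  have hX : covX N u = (-Complex.I) • covY N u := by
    refine Subtype.ext (funext fun p => ?_)
    have h : _ = (0 : ℂ) := congrFun (congrArg Subtype.val hu) p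
    rw [lowering_apply] at h
    exact (eq_neg_of_add_eq_zero_left h).trans (neg_mul _ _).symm
  have hd : ∀ x, HasDerivAt (yCoeff u m)
      ((2 * Real.pi * m - 2 * Real.pi * N * x) * yCoeff u m x) x := by
    intro x
    convert! hasDerivAt_yCoeff u m x using 1
    rw [hX, yCoeff_smul, yCoeff_covY]
    linear_combination (2 * Real.pi * m - 2 * Real.pi * N * x) * yCoeff u m x * Complex.I_sq
  have hg : ∀ x : ℝ, HasDerivAt (fun x : ℝ => yCoeff u m x *
      Complex.exp (-(2 * Real.pi * m * x - Real.pi * N * x ^ 2))) 0 x := by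
    intro x
    have hx := Complex.ofRealCLM.hasDerivAt (x := x)
    have h2 := ((hx.const_mul (2 * Real.pi * m : ℂ)).sub
      ((hx.pow 2).const_mul (Real.pi * N : ℂ))).neg.cexp
    convert! (hd x).mul h2 using 1
    simp
    ring
  have hc := is_const_of_deriv_eq_zero (fun x => (hg x).differentiableAt)
    (fun x => (hg x).deriv) x 0
  simp only [Complex.ofReal_zero] at hc
  norm_num at hc
  rw [← hc, mul_assoc, ← Complex.exp_add]
  simp

theorem eq_zero_of_yCoeff_eq_zero {N : ℕ} {u : Section N} (h : ∀ m x, yCoeff u m x = 0) :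
    u = 0 := by
  refine Subtype.ext (funext fun p => ?_)
  obtain ⟨x, y⟩ := p
  have hu := u.2.1.continuous
  have hper : Function.Periodic (fun y => (u : ℝ × ℝ → ℂ) (x, y)) 1 := fun y => u.2.2.2 x y
  have hcont : Continuous (hper.lift : UnitAddCircle → ℂ) :=
    Continuous.quotient_liftOn' (by fun_prop : Continuous fun y => (u : ℝ × ℝ → ℂ) (x, y)) _
  set f : C(UnitAddCircle, ℂ) := ⟨hper.lift, hcont⟩ with hf
  have hfy : ∀ y : ℝ, f (y : UnitAddCircle) = (u : ℝ × ℝ → ℂ) (x, y) := fun y => hper.lift_coe y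
  have hcoeff : fourierCoeff f = 0 := by
    funext m
    rw [fourierCoeff_eq_intervalIntegral _ _ 0, Pi.zero_apply]
    have := h m x
    rw [yCoeff] at this
    rw [zero_add, show (∫ y in (0 : ℝ)..1, fourier (-m) (y : UnitAddCircle) •
      f (y : UnitAddCircle)) = 0 from ?_, smul_zero]
    rw [← this]
    congr 1 with y
    rw [hfy, fourier_coe_apply, smul_eq_mul]
    congr 2
    push_cast
    ring
  have hs := has_pointwise_sum_fourier_series_of_summable (f := f)
    (by rw [hcoeff]; exact summable_zero) (y : UnitAddCircle)
  rw [hcoeff, hfy] at hs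
  simp only [Pi.zero_apply, zero_smul] at hs
  exact hs.unique hasSum_zero

/-- Translation by one in `x` shifts the Fourier index by `N`, and a coefficient vanishing at one
point vanishes identically; so one index in each residue class modulo `N` suffices. -/
theorem yCoeff_eq_zero_of_forall_lt {N : ℕ} (hN : 1 ≤ N) {u : Section N}
    (hu : lowering (covX N) (covY N) u = 0) (h : ∀ r < N, yCoeff u r 0 = 0) (m : ℤ) (x : ℝ) :
    yCoeff u m x = 0 := by
  have key : ∀ m : ℤ, yCoeff u m 0 = 0 → ∀ x, yCoeff u m x = 0 := fun m hm x => by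
    rw [yCoeff_eq hu, hm, zero_mul]
  have hN0 : (0 : ℤ) < N := by exact_mod_cast hN
  have h1 : ∀ (r : ℕ) (_ : r < N) (q : ℤ), ∀ x, yCoeff u (r + N * q) x = 0 := by
    intro r hr q
    induction q using Int.induction_on with
    | zero => exact key _ (by simpa using h r hr)
    | succ q ih =>
      refine key _ ?_
      have := ih (-1)
      rw [show (r + N * (q : ℤ) : ℤ) = r + N * (q + 1) - N by ring, ← yCoeff_add_one] at this
      simpa using this
    | pred q ih =>
      intro x
      rw [show (r + N * (-(q : ℤ) - 1) : ℤ) = r + N * (-q) - N by ring, ← yCoeff_add_one]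
      exact ih _
  have h2 := h1 (m % N).toNat (by have := Int.emod_lt_of_pos m hN0; omega) (m / N) x
  rwa [Int.toNat_of_nonneg (Int.emod_nonneg m hN0.ne'), Int.emod_add_mul_ediv] at h2

theorem rank_eigenspace_field_le {N : ℕ} (hN : 1 ≤ N) :
    Module.rank ℂ (Module.End.eigenspace (magneticLaplacian N) (field N)) ≤ N := by
  let Φ : Section N →ₗ[ℂ] (Fin N → ℂ) :=
    { toFun := fun u r => yCoeff u (r : ℕ) 0
      map_add' := fun u v => funext fun r => yCoeff_add u v _ _
      map_smul' := fun a u => funext fun r => yCoeff_smul a u _ _ }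
  have hinj : Function.Injective
      (Φ ∘ₗ (Module.End.eigenspace (magneticLaplacian N) (field N)).subtype) := by
    rw [injective_iff_map_eq_zero]
    intro u hu
    have hl := (mem_eigenspace_field_iff hN _).1 u.2
    exact Subtype.ext (eq_zero_of_yCoeff_eq_zero fun m x =>
      yCoeff_eq_zero_of_forall_lt hN hl (fun r hr => congrFun hu ⟨r, hr⟩) m x)
  simpa using LinearMap.rank_le_of_injective _ hinj

/-! ### The lowest Landau level: theta functions -/

/-- The holomorphic factor of the `r`-th theta function. -/
noncomputable def thetaHol (N r : ℕ) (z : ℂ) : ℂ :=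
  Complex.exp (-(Real.pi * r ^ 2 / N) + 2 * Real.pi * r * z) *
    jacobiTheta₂ (-Complex.I * (N * z - r)) (Complex.I * N)

theorem im_I_mul_pos {N : ℕ} (hN : 1 ≤ N) : 0 < (Complex.I * N).im := by
  simp
  omega

theorem differentiable_thetaHol {N : ℕ} (hN : 1 ≤ N) (r : ℕ) :
    Differentiable ℂ (thetaHol N r) := by
  have h : Differentiable ℂ fun w => jacobiTheta₂ w (Complex.I * N) :=
    fun w => differentiableAt_jacobiTheta₂_fst w (im_I_mul_pos hN)
  unfold thetaHol
  exact Differentiable.mul (by fun_prop)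
    (h.comp (by fun_prop : Differentiable ℂ fun z : ℂ => -Complex.I * (N * z - r)))

theorem jacobiTheta₂_add_nat (w τ : ℂ) (n : ℕ) : jacobiTheta₂ (w + n) τ = jacobiTheta₂ w τ := by
  induction n with
  | zero => simp
  | succ n ih => rw [Nat.cast_succ, ← add_assoc, jacobiTheta₂_add_left, ih]

/-- `thetaHol N r z` is the series of `exp(2πmz - πm²/N)` over `m ≡ r` modulo `N`, so translation by
`i/N` acts by a root of unity. -/
theorem thetaHol_add_I_div {N : ℕ} (hN : 1 ≤ N) (r : ℕ) (z : ℂ) :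
    thetaHol N r (z + Complex.I / N) =
      Complex.exp (2 * Real.pi * Complex.I / N) ^ r * thetaHol N r z := by
  have hN0 : (N : ℂ) ≠ 0 := by exact_mod_cast (by omega : N ≠ 0)
  have e : -Complex.I * (N * (z + Complex.I / N) - r) =
      -Complex.I * (N * z - r) + (1 : ℕ) := by
    push_cast
    field_simp
    linear_combination -Complex.I_sq
  rw [thetaHol, thetaHol, e, jacobiTheta₂_add_nat, ← Complex.exp_nat_mul, ← mul_assoc,
    ← Complex.exp_add]
  congr 2
  field_simp
  ring

theorem thetaHol_add_I {N : ℕ} (r : ℕ) (z : ℂ) :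
    thetaHol N r (z + Complex.I) = thetaHol N r z := by
  have e : -Complex.I * (N * (z + Complex.I) - r) = -Complex.I * (N * z - r) + N := by
    linear_combination -(N : ℂ) * Complex.I_sq
  rw [thetaHol, thetaHol, e, jacobiTheta₂_add_nat,
    show -(Real.pi * r ^ 2 / N : ℂ) + 2 * Real.pi * r * (z + Complex.I) =
      -(Real.pi * r ^ 2 / N : ℂ) + 2 * Real.pi * r * z + r * (2 * Real.pi * Complex.I) by ring,
    Complex.exp_add _ (r * (2 * Real.pi * Complex.I)), Complex.exp_nat_mul_two_pi_mul_I, mul_one]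

theorem thetaHol_add_one {N : ℕ} (r : ℕ) (z : ℂ) :
    thetaHol N r (z + 1) = Complex.exp (2 * Real.pi * N * z + Real.pi * N) * thetaHol N r z := by
  have h := jacobiTheta₂_add_left' (-Complex.I * (N * (z + 1) - r)) (Complex.I * N)
  rw [show -Complex.I * (N * (z + 1) - r) + Complex.I * N = -Complex.I * (N * z - r) by ring] at h
  rw [thetaHol, thetaHol, h, ← mul_assoc, ← mul_assoc, ← Complex.exp_add, ← Complex.exp_add]
  congr 2
  linear_combination (-2 * Real.pi * (N * (z + 1) - r) + Real.pi * N : ℂ) * Complex.I_sq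

/-- The theta functions, which span the lowest Landau level. -/
noncomputable def theta (N r : ℕ) (p : ℝ × ℝ) : ℂ :=
  Complex.exp (-(Real.pi * N * (p.1 : ℂ) ^ 2)) * thetaHol N r (p.1 + p.2 * Complex.I)

theorem theta_mem {N : ℕ} (hN : 1 ≤ N) (r : ℕ) : theta N r ∈ Section N := by
  refine ⟨?_, fun x y => ?_, fun x y => ?_⟩
  · have h1 : ContDiff ℝ ∞ fun p : ℝ × ℝ => (p.1 : ℂ) :=
      Complex.ofRealCLM.contDiff.comp contDiff_fst
    have h2 : ContDiff ℝ ∞ fun p : ℝ × ℝ => (p.2 : ℂ) :=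
      Complex.ofRealCLM.contDiff.comp contDiff_snd
    have h3 : ContDiff ℝ ∞ (thetaHol N r) :=
      ((differentiable_thetaHol hN r).contDiff (n := ∞)).restrict_scalars ℝ
    exact (contDiff_const.mul (h1.pow 2)).neg.cexp.mul
      (h3.comp (h1.add (h2.mul contDiff_const)))
  · simp only [theta]
    rw [show ((x + 1 : ℝ) : ℂ) + y * Complex.I = x + y * Complex.I + 1 by push_cast; ring,
      thetaHol_add_one, ← mul_assoc, ← mul_assoc, ← Complex.exp_add, ← Complex.exp_add]
    congr 2
    push_cast
    ring
  · simp only [theta]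
    rw [show (x : ℂ) + ((y + 1 : ℝ) : ℂ) * Complex.I = x + y * Complex.I + Complex.I by
      push_cast; ring, thetaHol_add_I]

/-- Removing the Gaussian factor `exp(-πNx²)` turns the lowering operator into `∂_x + i∂_y`, which
kills holomorphic functions. -/
theorem lowering_theta {N : ℕ} (hN : 1 ≤ N) (r : ℕ) :
    lowering (covX N) (covY N) ⟨theta N r, theta_mem hN r⟩ = 0 := by
  refine Subtype.ext (funext fun p => ?_)
  obtain ⟨x, y⟩ := p
  have hg := ((differentiable_thetaHol hN r) (x + y * Complex.I)).hasDerivAt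
  set g' := deriv (thetaHol N r) (x + y * Complex.I)
  have hid := Complex.ofRealCLM.hasDerivAt (x := 0)
  have hx : HasDerivAt (fun t : ℝ => theta N r (x + t, y))
      (Complex.exp (-(Real.pi * N * (x : ℂ) ^ 2)) * (g' - 2 * Real.pi * N * x *
        thetaHol N r (x + y * Complex.I))) 0 := by
    have h1 := (((hid.const_add (x : ℂ)).pow 2).const_mul (Real.pi * N : ℂ)).neg.cexp
    have h2 := HasDerivAt.scomp (h := fun t : ℝ => (x : ℂ) + t + y * Complex.I) (0 : ℝ)
      (by simpa using hg) ((hid.const_add (x : ℂ)).add_const (y * Complex.I))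
    convert! h1.mul h2 using 1
    · funext t
      simp [theta]
    · simp
      ring
  have hy : HasDerivAt (fun t : ℝ => Complex.exp (-(2 * Real.pi * Complex.I * N * x) * t) *
      theta N r (x, y + t))
      (Complex.exp (-(Real.pi * N * (x : ℂ) ^ 2)) * (Complex.I * g' -
        2 * Real.pi * Complex.I * N * x * thetaHol N r (x + y * Complex.I))) 0 := by
    have h1 := (hid.const_mul (-(2 * Real.pi * Complex.I * N * x))).cexp
    have h2 := HasDerivAt.scomp (h := fun t : ℝ => (x : ℂ) + (y + t) * Complex.I) (0 : ℝ)
      (by simpa using hg) (((hid.const_add (y : ℂ)).mul_const Complex.I).const_add (x : ℂ))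
    convert! h1.mul (h2.const_mul (Complex.exp (-(Real.pi * N * (x : ℂ) ^ 2)))) using 1
    · funext t
      simp [theta]
    · simp
      ring
  have ex := hx.unique (hasDerivAt_line_x ⟨theta N r, theta_mem hN r⟩ (x, y) 0)
  have ey := hy.unique (hasDerivAt_line_y ⟨theta N r, theta_mem hN r⟩ (x, y) 0)
  simp only [add_zero, Complex.ofReal_zero, mul_zero, Complex.exp_zero, one_mul] at ex ey
  rw [lowering_apply, ← ex, ← ey]
  simp only [Submodule.coe_zero, Pi.zero_apply]
  linear_combination Complex.exp (-(Real.pi * N * (x : ℂ) ^ 2)) * (g' - 2 * Real.pi * N * x *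
        thetaHol N r (x + y * Complex.I)) * Complex.I_sq

/-- At `τ = iN` and argument `0` all terms of the series are positive. -/
theorem jacobiTheta₂_zero_ne_zero {N : ℕ} (hN : 1 ≤ N) : jacobiTheta₂ 0 (Complex.I * N) ≠ 0 := by
  have h := Complex.hasSum_re (hasSum_jacobiTheta₂_term 0 (im_I_mul_pos hN))
  have e : ∀ n : ℤ, (jacobiTheta₂_term n 0 (Complex.I * N)).re =
      Real.exp (-(Real.pi * n ^ 2 * N)) := by
    intro n
    rw [jacobiTheta₂_term, ← Complex.ofReal_re (Real.exp _)]
    congr 1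
    push_cast
    congr 1
    linear_combination (Real.pi * n ^ 2 * N : ℂ) * Complex.I_sq
  simp only [e] at h
  intro h0
  have := le_hasSum h 0 fun n _ => (Real.exp_pos _).le
  norm_num [h0] at this

theorem theta_ne_zero {N : ℕ} (hN : 1 ≤ N) (r : ℕ) : theta N r ≠ 0 := by
  intro h
  have hN0 : (N : ℂ) ≠ 0 := by exact_mod_cast (by omega : N ≠ 0)
  -- At this point the argument of the Jacobi theta function is `0`.
  have h1 := congrFun h ((r : ℝ) / N, 0)
  have e : -Complex.I * (N * (((r / N : ℝ) : ℂ) + ((0 : ℝ) : ℂ) * Complex.I) - r) = 0 := by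
    push_cast
    field_simp
    simp
  simp only [theta, thetaHol, e, Pi.zero_apply, mul_eq_zero, Complex.exp_ne_zero, false_or] at h1
  exact jacobiTheta₂_zero_ne_zero hN h1

/-- The theta functions are eigenvectors of translation by `1/N` in `y` with distinct eigenvalues,
the powers of a primitive `N`-th root of unity. -/
theorem linearIndependent_theta {N : ℕ} (hN : 1 ≤ N) :
    LinearIndependent ℂ fun r : Fin N => theta N r := by
  have hprim := Complex.isPrimitiveRoot_exp N (by omega)
  have hN0 : (N : ℂ) ≠ 0 := by exact_mod_cast (by omega : N ≠ 0)
  refine Module.End.eigenvectors_linearIndependent' (ι := Fin N) (M := ℝ × ℝ → ℂ)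
    (LinearMap.funLeft ℂ ℂ fun p : ℝ × ℝ => (p.1, p.2 + 1 / (N : ℝ)))
    (fun r => Complex.exp (2 * Real.pi * Complex.I / N) ^ (r : ℕ)) ?_
    (fun r : Fin N => theta N r) fun r => ?_
  · intro r s hrs
    exact Fin.ext (hprim.pow_inj r.2 s.2 hrs)
  · refine ⟨Module.End.mem_eigenspace_iff.2 (funext fun p => ?_), theta_ne_zero hN r⟩
    simp only [LinearMap.funLeft_apply, Pi.smul_apply, smul_eq_mul, theta]
    rw [show (p.1 : ℂ) + ((p.2 + 1 / N : ℝ) : ℂ) * Complex.I =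
      p.1 + p.2 * Complex.I + Complex.I / N by push_cast; ring, thetaHol_add_I_div hN]
    ring

theorem rank_eigenspace_field {N : ℕ} (hN : 1 ≤ N) :
    Module.rank ℂ (Module.End.eigenspace (magneticLaplacian N) (field N)) = N := by
  refine le_antisymm (rank_eigenspace_field_le hN) ?_
  let v : Fin N → Module.End.eigenspace (magneticLaplacian N) (field N) := fun r =>
    ⟨⟨theta N r, theta_mem hN r⟩, (mem_eigenspace_field_iff hN _).2 (lowering_theta hN r)⟩
  have hv : LinearIndependent ℂ v := LinearIndependent.of_comp
    ((Section N).subtype ∘ₗ (Module.End.eigenspace (magneticLaplacian N) (field N)).subtype)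
    (linearIndependent_theta hN)
  simpa using hv.cardinal_le_rank

/-! ### The list of eigenvalues -/

/-- The eigenvalues of the magnetic Laplacian in increasing order, with multiplicity. -/
noncomputable def eigenvalueList (N j : ℕ) : ℝ := landauLevel N ((j / N : ℕ) : ℝ)

theorem ofReal_landauLevel (N n : ℕ) : ((landauLevel N n : ℝ) : ℂ) = (2 * n + 1) * field N := by
  rw [landauLevel, field]
  push_cast
  ring

theorem field_ne_zero {N : ℕ} (hN : 1 ≤ N) : field N ≠ 0 := by
  have h1 : (Real.pi : ℂ) ≠ 0 := by exact_mod_cast Real.pi_ne_zero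
  have h2 : (N : ℂ) ≠ 0 := by exact_mod_cast (by omega : N ≠ 0)
  simp [field, h1, h2]

theorem isEigenvalueList_eigenvalueList {N : ℕ} (hN : 1 ≤ N) :
    IsEigenvalueList N (eigenvalueList N) := by
  intro μ
  by_cases hμ : ∃ n : ℕ, μ = (2 * n + 1) * field N
  · obtain ⟨n, rfl⟩ := hμ
    rw [rank_eigenspace_level N hN, rank_eigenspace_field hN, ← Cardinal.mk_fin]
    refine Cardinal.mk_congr ((Equiv.subtypeEquivRight fun j => ?_).trans
      (?_ : {j : ℕ // j / N = n} ≃ Fin N))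
    · rw [eigenvalueList, ofReal_landauLevel, mul_left_inj' (field_ne_zero hN)]
      norm_cast
      omega
    · exact
        { toFun := fun j => ⟨j.1 % N, Nat.mod_lt _ hN⟩
          invFun := fun r => ⟨r + N * n, by
            rw [Nat.add_mul_div_left _ _ hN, Nat.div_eq_of_lt r.2, zero_add]⟩
          left_inv := fun j => Subtype.ext (by
            conv_rhs => rw [← Nat.mod_add_div j.1 N, j.2])
          right_inv := fun r => Fin.ext (by simp [Nat.mod_eq_of_lt r.2]) }
  · push Not at hμ
    rw [rank_eigenspace_eq_zero N hN hμ, Cardinal.mk_eq_zero_iff]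
    exact ⟨fun j => hμ _ (j.2.symm.trans (ofReal_landauLevel N _))⟩

/-- Fibres over each value have equal cardinality, so they can be matched one by one. Thus `Y` does
not depend on the chosen list. -/
theorem exists_perm_of_isEigenvalueList {N : ℕ} {ν ν' : ℕ → ℝ} (hν : IsEigenvalueList N ν)
    (hν' : IsEigenvalueList N ν') : ∃ e : ℕ ≃ ℕ, ∀ j, ν j = ν' (e j) := by
  have h : ∀ c : ℂ, Nonempty ({j // (ν j : ℂ) = c} ≃ {j // (ν' j : ℂ) = c}) := fun c =>
    Cardinal.eq.1 ((hν c).trans (hν' c).symm)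
  refine ⟨Equiv.ofFiberEquiv fun c => (h c).some, fun j => ?_⟩
  exact_mod_cast (Equiv.ofFiberEquiv_map (fun c => (h c).some) j).symm

/-- Writing `j = r + N n` with `r < N` splits the list into levels, each repeated `N` times. -/
theorem hasSum_summand_eigenvalueList {E : ℝ} (hE : 1 < E) (φ : 𝓢(ℝ, ℂ)) {N : ℕ} (hN : 1 ≤ N) :
    HasSum (summand φ E N (eigenvalueList N)) (N * ∑' n : ℤ, levelSummand φ E N n) := by
  have : NeZero N := ⟨by omega⟩
  have h1 : HasSum (fun n : ℕ => levelSummand φ E N n) (∑' n : ℤ, levelSummand φ E N n) := by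
    refine (Function.Injective.hasSum_iff (f := levelSummand φ E N)
      (g := fun n : ℕ => (n : ℤ)) Nat.cast_injective fun n hn => ?_).2
      (summable_levelSummand hE φ hN).hasSum
    rw [levelSummand, if_neg]
    intro h
    exact hn ⟨n.toNat, Int.toNat_of_nonneg h⟩
  have h2 : HasSum (fun p : ℕ × Fin N => levelSummand φ E N p.1)
      (N * ∑' n : ℤ, levelSummand φ E N n) := by
    have hs : Summable fun p : ℕ × Fin N => levelSummand φ E N p.1 := by
      have := h1.summable.norm.mul_of_nonneg (Summable.of_finite (f := fun _ : Fin N => (1 : ℝ)))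
        (fun _ => norm_nonneg _) (fun _ => zero_le_one)
      exact Summable.of_norm (by simpa using this)
    convert! hs.hasSum using 1
    rw [hs.tsum_prod, ← h1.tsum_eq, ← tsum_mul_left]
    simp
  refine ((Nat.divModEquiv N).symm.hasSum_iff).1 ?_
  convert! h2 using 1
  funext p
  have hp : ((Nat.divModEquiv N).symm p : ℕ) / N = p.1 := by
    simpa using congrArg Prod.fst ((Nat.divModEquiv N).apply_symm_apply p)
  rw [Function.comp, summand, eigenvalueList, hp, levelSummand, if_pos (by positivity)]
  simp

theorem hasSum_summand {E : ℝ} (hE : 1 < E) (φ : 𝓢(ℝ, ℂ)) {N : ℕ} (hN : 1 ≤ N) {ν : ℕ → ℝ}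
    (hν : IsEigenvalueList N ν) :
    HasSum (summand φ E N ν) (N * ∑' n : ℤ, levelSummand φ E N n) := by
  obtain ⟨e, he⟩ := exists_perm_of_isEigenvalueList hν (isEigenvalueList_eigenvalueList hN)
  convert! e.hasSum_iff.2 (hasSum_summand_eigenvalueList hE φ hN) using 1
  funext j
  simp only [summand, Function.comp, he j]

end MagneticTorus

/-! ### The main theorem -/

theorem theorem3p1 (E : ℝ) (hE : 1 < E) :
    (∀ N : ℕ, 1 ≤ N → ∃ ν : ℕ → ℝ, MagneticTorus.IsEigenvalueList N ν) ∧
    ∃ P : ℕ → ℕ → Polynomial ℂ, ∀ φ : 𝓢(ℝ, ℂ), ∃ c : ℕ → ℕ → ℂ,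
      -- the coefficients `c j N` are bounded in `N`
      (∀ j : ℕ, ∃ M : ℝ, ∀ N : ℕ, 1 ≤ N → ‖c j N‖ ≤ M) ∧
      -- the asymptotic expansion of `Y_N(φ)`
      (∀ ν : ℕ → ℕ → ℝ, (∀ N : ℕ, 1 ≤ N → MagneticTorus.IsEigenvalueList N (ν N)) →
        (∀ N : ℕ, 1 ≤ N → Summable (MagneticTorus.summand φ E N (ν N))) ∧
        ∀ J : ℕ,
          (fun N : ℕ => MagneticTorus.Y φ E N (ν N) -
              ∑ j ∈ Finset.range J, c j N * (N : ℂ) ^ (1 - (j : ℤ)))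
            =O[atTop] (fun N : ℕ => (N : ℝ) ^ (1 - (J : ℤ)))) ∧
      -- the form of all coefficients
      (∀ j N : ℕ, 1 ≤ N →
        HasSum (fun k : ℤ =>
          (∑ m ∈ Finset.range (2 * j + 1),
            (P j m).eval (k : ℂ) * iteratedDeriv m (MagneticTorus.hat φ) (k * E)) *
              MagneticTorus.phase E N k)
          (c j N)) ∧
      -- the first coefficient
      (∀ N : ℕ, 1 ≤ N →
        HasSum (fun k : ℤ =>
          (E / (2 * Real.pi) : ℂ) * (MagneticTorus.hat φ (k * E) * MagneticTorus.phase E N k))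
          (c 0 N)) ∧
      -- the second coefficient
      (∀ N : ℕ, 1 ≤ N →
        HasSum (fun k : ℤ =>
          (Complex.I / (2 * Real.pi) * deriv (MagneticTorus.hat φ) (k * E) +
              Complex.I * k * E / (4 * Real.pi) *
                iteratedDeriv 2 (MagneticTorus.hat φ) (k * E)) *
            MagneticTorus.phase E N k)
          (c 1 N)) := by
  refine ⟨fun N hN => ⟨_, MagneticTorus.isEigenvalueList_eigenvalueList hN⟩, ?_⟩
  obtain ⟨P, hP⟩ := MagneticTorus.exists_polynomial_hasSum_coeff hE
  refine ⟨P, fun φ => ⟨MagneticTorus.coeff E φ, fun j => ?_, fun ν hν => ⟨fun N hN => ?_,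
    fun J => ?_⟩, fun j N _ => hP φ j N, fun N _ => MagneticTorus.hasSum_coeff_zero hE φ N,
    fun N _ => MagneticTorus.hasSum_coeff_one hE φ N⟩⟩
  · obtain ⟨M, hM⟩ := MagneticTorus.exists_bound_coeff hE φ j
    exact ⟨M, fun N _ => hM N⟩
  · exact (MagneticTorus.hasSum_summand hE φ hN (hν N hN)).summable
  · obtain ⟨C, hC⟩ := MagneticTorus.exists_bound_expansion hE φ J
    refine IsBigO.of_bound C ?_
    filter_upwards [eventually_ge_atTop 1] with N hN
    rw [MagneticTorus.Y, (MagneticTorus.hasSum_summand hE φ hN (hν N hN)).tsum_eq,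
      Real.norm_of_nonneg (by positivity)]
    exact hC N hN
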